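/- Let $A$ be a finite alphabet and $u=u_0u_1u_2\cdots\in A^{\mathbb N}$ an infinite word. Let $S$ be the shift on $A^{\mathbb N}$ and $X=\overline{\{S^nu : n\in\mathbb N\}}$ the subshift generated by $u$ ($A^{\mathbb N}$ has the product topology, $X$ its Borel $\sigma$-algebra). Write $(e_a)_{a\in A}$ for the canonical basis of $\mathbb Z^A$ and $\mathrm{Ab}(v)=(|v|_a)_{a\in A}\in\mathbb Z^A$ for the vector counting the occurrences of each letter in a finite word $v$. Put $$D_u=\{\mathrm{Ab}(v): v \text{ a finite prefix of } u\},\qquad D_{u,a}=\{\mathrm{Ab}(v): va \text{ a finite prefix of } u\},$$ and let $\Gamma_0$ be the subgroup of $\mathbb Z^A$ generated by the vectors $e_a-e_b$, $a,b\in A$. Let $\pi$ be a linear projection of $\mathbb R^A$ onto a hyperplane $\mathcal P$ (a linear subspace of codimension one), and let $\lambda$ be the Lebesgue measure of $\mathcal P$. Assume that - $\pi(\mathbb Z^A)$ is dense in $\mathcal P$; - $\pi(D_u)$ is bounded; - $(X,S)$ is minimal; - for every $a\in A$ the boundary in $\mathcal P$ of $\overline{\pi(D_{u,a})}$ has zero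 Lebesgue measure; - the sets $\overline{\pi(D_{u,a})}$, $a\in A$, whose union is $\overline{\pi(D_u)}$, are pairwise disjoint in Lebesgue measure: $\lambda(\overline{\pi(D_{u,a})}\cap\overline{\pi(D_{u,b})})=0$ for $a\ne b$. On the quotient $\mathcal P/\pi(\Gamma_0)$, let $T$ be the translation by $\pi(e_a)$ (the same map for all $a\in A$), and let $\bar\lambda$ be the normalised Lebesgue (Haar) measure, which is a probability measure. Then there are an $S$-invariant Borel probability measure $\mu$ on $X$ and a map $\varphi:X\to\mathcal P/\pi(\Gamma_0)$ such that: 1. $\varphi$ is a topological semi-conjugacy from $(X,S)$ onto $(\mathcal P/\pi(\Gamma_0),T)$, that is, $\varphi$ is continuous and surjective and $\varphi\circ S=T\circ\varphi$; 2. $\varphi$ makes $(X,S,\mu)$ a finite extension of $(\mathcal P/\pi(\Gamma_0),T,\bar\lambda)$, that is, $T$ preserves $\bar\lambda$, $\varphi_*\mu=\bar\lambda$, and there is an integer $k\ge1$ such that $\varphi^{-1}(y)$ has exactly $k$ elements for $\bar\lambda$-almost every $y$. If moreover the translates $\overline{\pi(D_u)}+t$, $t\in\pi(\Gamma_0)$,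 are pairwise disjoint in Lebesgue measure, then: 3. $(X,S)$ is uniquely ergodic (so $\mu$ is its only invariant Borel probability measure); 4. $(X,S,\mu)$ is isomorphic, modulo null sets, to the measure-preserving system $(\mathcal P/\pi(\Gamma_0),T,\bar\lambda)$; 5. $(X,S,\mu)$ is isomorphic, modulo null sets, to the measure-preserving system given by the domain exchange $E$ on $\overline{\pi(D_u)}$ with normalised Lebesgue measure, where $E(x)=x+\pi(e_a)$ if $a$ is the only letter with $x\in\overline{\pi(D_{u,a})}$ (this defines $E$ almost everywhere). -/

import Mathlib

open MeasureTheory Set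

noncomputable section

/-! ### Notions from dynamics -/

/-- A dynamical system is minimal if every (forward) orbit is dense. -/
def IsMinimalSystem {X : Type*} [TopologicalSpace X] (S : X → X) : Prop :=
  ∀ x : X, Dense (range fun n : ℕ => S^[n] x)

/-- `φ` is a topological semi-conjugacy from `(X, S)` onto `(Y, T)`. -/
structure IsTopSemiconjugacy {X Y : Type*} [TopologicalSpace X] [TopologicalSpace Y]
    (S : X → X) (T : Y → Y) (φ : X → Y) : Prop where
  continuous : Continuous φ
  surjective : Function.Surjective φ
  semiconj : ∀ x, φ (S x) = T (φ x)

/-- `φ` presents `(X, S, μ)` as a finite extension of `(Y, T, ν)`: it is a factor map of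
measure-preserving systems, and for some `k ≥ 1` almost every point has exactly `k` preimages. -/
structure IsFiniteExtension {X Y : Type*} [MeasurableSpace X] [MeasurableSpace Y]
    (S : X → X) (μ : Measure X) (T : Y → Y) (ν : Measure Y) (φ : X → Y) : Prop where
  source : MeasurePreserving S μ μ
  target : MeasurePreserving T ν ν
  map : MeasurePreserving φ μ ν
  semiconj : ∀ᵐ x ∂μ, φ (S x) = T (φ x)
  fibres : ∃ k : ℕ, 1 ≤ k ∧ ∀ᵐ y ∂ν, (φ ⁻¹' {y}).encard = k

/-- The measure-preserving systems `(X, S, μ)` and `(Y, T, ν)` are isomorphic (modulo null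
sets). -/
def MeasurablyIsomorphic {X Y : Type*} [MeasurableSpace X] [MeasurableSpace Y]
    (S : X → X) (μ : Measure X) (T : Y → Y) (ν : Measure Y) : Prop :=
  MeasurePreserving S μ μ ∧ MeasurePreserving T ν ν ∧
  ∃ (φ : X → Y) (ψ : Y → X), MeasurePreserving φ μ ν ∧ MeasurePreserving ψ ν μ ∧
    (∀ᵐ x ∂μ, ψ (φ x) = x) ∧ (∀ᵐ y ∂ν, φ (ψ y) = y) ∧ (∀ᵐ x ∂μ, φ (S x) = T (φ x))

/-- There is exactly one invariant probability measure. -/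
def IsUniquelyErgodic {X : Type*} [MeasurableSpace X] (S : X → X) : Prop :=
  ∃! ν : Measure X, IsProbabilityMeasure ν ∧ MeasurePreserving S ν ν

/-! ### Subshift generated by an infinite word -/

/-- The shift on infinite words. -/
def shift {A : Type*} (w : ℕ → A) : ℕ → A := fun i => w (i + 1)

/-- The closure of the orbit of `u` under the shift. -/
def subshift {A : Type*} [TopologicalSpace A] (u : ℕ → A) : Set (ℕ → A) :=
  closure (range fun n : ℕ => shift^[n] u)

theorem continuous_shift {A : Type*} [TopologicalSpace A] :
    Continuous (shift : (ℕ → A) → ℕ → A) :=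
  continuous_pi fun i => continuous_apply (i + 1)

theorem shift_mem_subshift {A : Type*} [TopologicalSpace A] (u : ℕ → A) :
    MapsTo shift (subshift u) (subshift u) := by
  refine MapsTo.closure ?_ continuous_shift
  rintro _ ⟨n, rfl⟩
  exact ⟨n + 1, Function.iterate_succ_apply' shift n u⟩

/-- The shift acting on the subshift generated by `u`. -/
def subshiftMap {A : Type*} [TopologicalSpace A] (u : ℕ → A) : subshift u → subshift u :=
  (shift_mem_subshift u).restrict

/-! ### Discrete line of an infinite word and its projection -/

section DiscreteLine

variable {A : Type*} [DecidableEq A]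

/-- The abelianisation of a finite word: the vector of numbers of occurrences. -/
def abelianVector (v : List A) : A → ℤ := fun a => (v.count a : ℤ)

/-- The canonical basis vector `e_a` of `ℤ^A`. -/
def basisVec (a : A) : A → ℤ := Pi.single a 1

/-- The prefix of length `n` of an infinite word. -/
def wordPrefix (u : ℕ → A) (n : ℕ) : List A := (List.range n).map u

/-- `D_u`: the abelianisations of the finite prefixes of `u`. -/
def discreteLine (u : ℕ → A) : Set (A → ℤ) :=
  {x | ∃ n : ℕ, x = abelianVector (wordPrefix u n)}

/-- `D_{u,a}`: the abelianisations of the finite words `v` such that `va` is a prefix of `u`. -/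
def discretePiece (u : ℕ → A) (a : A) : Set (A → ℤ) :=
  {x | ∃ (v : List A) (n : ℕ), v ++ [a] = wordPrefix u n ∧ x = abelianVector v}

/-- The subgroup `Γ₀` of `ℤ^A` generated by the differences `e_a - e_b`. -/
def Gamma0 (A : Type*) [DecidableEq A] : AddSubgroup (A → ℤ) :=
  AddSubgroup.closure {x | ∃ a b : A, x = basisVec a - basisVec b}

theorem abelianVector_append_singleton (v : List A) (a : A) :
    abelianVector (v ++ [a]) = abelianVector v + basisVec a := by
  ext b
  by_cases h : b = a
  · subst h; simp [abelianVector, basisVec]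
  · simp [abelianVector, basisVec, h, Ne.symm h]

variable [Fintype A] {P : Submodule ℝ (EuclideanSpace ℝ A)}

/-- The restriction to `ℤ^A` of a linear map `π : ℝ^A → P`. -/
def intProj (π : EuclideanSpace ℝ A →ₗ[ℝ] P) : (A → ℤ) →+ P where
  toFun x := π (WithLp.toLp 2 fun a => (x a : ℝ))
  map_zero' := by
    rw [← map_zero π]; congr 1; ext a; simp
  map_add' x y := by
    rw [← map_add π]; congr 1; ext a; simp

/-- The closure of `π(D_u)` in the hyperplane. -/
def tile (π : EuclideanSpace ℝ A →ₗ[ℝ] P) (u : ℕ → A) : Set P :=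
  closure (intProj π '' discreteLine u)

/-- The closure of `π(D_{u,a})` in the hyperplane. -/
def tilePiece (π : EuclideanSpace ℝ A →ₗ[ℝ] P) (u : ℕ → A) (a : A) : Set P :=
  closure (intProj π '' discretePiece u a)

/-- The subgroup `π(Γ₀)` of the hyperplane. -/
def projGamma0 (π : EuclideanSpace ℝ A →ₗ[ℝ] P) : AddSubgroup P :=
  (Gamma0 A).map (intProj π)

theorem add_mem_tile (π : EuclideanSpace ℝ A →ₗ[ℝ] P) (u : ℕ → A) (a : A) {x : P}
    (hx : x ∈ tilePiece π u a) : x + intProj π (basisVec a) ∈ tile π u := by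
  have h : MapsTo (fun y : P => y + intProj π (basisVec a))
      (intProj π '' discretePiece u a) (intProj π '' discreteLine u) := by
    rintro _ ⟨_, ⟨v, n, hv, rfl⟩, rfl⟩
    refine ⟨abelianVector (v ++ [a]), ⟨n, by rw [hv]⟩, ?_⟩
    rw [abelianVector_append_singleton, map_add]
  exact h.closure (continuous_add_const _) hx

open Classical in
/-- The domain exchange on the closure of `π(D_u)`: translation by `π(e_a)` at the points that
lie in the closure of `π(D_{u,a})` for exactly one letter `a`; points lying in several pieces (a
null set when the pieces are disjoint in measure) are left fixed, by convention. -/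
def domainExchange (π : EuclideanSpace ℝ A →ₗ[ℝ] P) (u : ℕ → A) (x : tile π u) : tile π u :=
  if h : ∃! a : A, (x : P) ∈ tilePiece π u a then
    ⟨x + intProj π (basisVec h.choose), add_mem_tile π u h.choose h.choose_spec.1⟩
  else x

/-- Lebesgue measure on the hyperplane, restricted to the closure of `π(D_u)` and normalised to
be a probability measure. -/
def tileMeasure (π : EuclideanSpace ℝ A →ₗ[ℝ] P) (u : ℕ → A) : Measure (tile π u) :=
  (volume (tile π u))⁻¹ • (volume : Measure P).comap Subtype.val

/-! ### The torus `P / π(Γ₀)` -/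

/-- The quotient group `P / π(Γ₀)`, with its quotient topology and Borel `σ`-algebra. -/
def ProjTorus (π : EuclideanSpace ℝ A →ₗ[ℝ] P) : Type _ := P ⧸ projGamma0 π

instance (π : EuclideanSpace ℝ A →ₗ[ℝ] P) : AddCommGroup (ProjTorus π) :=
  inferInstanceAs (AddCommGroup (P ⧸ projGamma0 π))

instance (π : EuclideanSpace ℝ A →ₗ[ℝ] P) : TopologicalSpace (ProjTorus π) :=
  inferInstanceAs (TopologicalSpace (P ⧸ projGamma0 π))

instance (π : EuclideanSpace ℝ A →ₗ[ℝ] P) : IsTopologicalAddGroup (ProjTorus π) :=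
  inferInstanceAs (IsTopologicalAddGroup (P ⧸ projGamma0 π))

instance (π : EuclideanSpace ℝ A →ₗ[ℝ] P) : LocallyCompactSpace (ProjTorus π) :=
  inferInstanceAs (LocallyCompactSpace (P ⧸ projGamma0 π))

instance (π : EuclideanSpace ℝ A →ₗ[ℝ] P) : MeasurableSpace (ProjTorus π) := borel _

instance (π : EuclideanSpace ℝ A →ₗ[ℝ] P) : BorelSpace (ProjTorus π) := ⟨rfl⟩

/-- The quotient homomorphism from the hyperplane to the torus. -/
def torusMk (π : EuclideanSpace ℝ A →ₗ[ℝ] P) : P →+ ProjTorus π :=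
  QuotientAddGroup.mk' (projGamma0 π)

/-- The translation by `π(e_a)` on `P / π(Γ₀)`. -/
def torusTranslation (π : EuclideanSpace ℝ A →ₗ[ℝ] P) (a : A) (x : ProjTorus π) : ProjTorus π :=
  x + torusMk π (intProj π (basisVec a))

/-- The normalised Lebesgue (i.e. Haar) measure on the torus `P / π(Γ₀)`. -/
def torusMeasure (π : EuclideanSpace ℝ A →ₗ[ℝ] P) : Measure (ProjTorus π) :=
  ((Measure.addHaar : Measure (ProjTorus π)) univ)⁻¹ • Measure.addHaar

end DiscreteLine

end

/-! Reading letters along an orbit is a walk in the hyperplane, and the walk of `u` visits exactly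
the bounded set π(D_u). Its steps form the cocycle x ↦ π(e_{x₀}) over a minimal system, so
Gottschalk–Hedlund (`IsMinimalSystem.exists_continuous_coboundary`) makes it a coboundary: there is
a continuous position map g with g(Sx) = g(x) + π(e_{x₀}) and g(Sⁿu) the n-th point of π(D_u)
(`IsPositionMap`). Its image is the tile, and g(x) lies in the piece labelled x₀. Modulo π(Γ₀) all
steps agree, so φ = g mod π(Γ₀) intertwines S with T.

Boundedness also forces ker π out of the hyperplane of zero coordinate sum. Hence π(Γ₀) is a lattice
(`exists_basis_projGamma0`) and the quotient is a compact torus. Density of π(ℤ^A) gives T dense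
orbits, so T is ergodic, Haar measure is its only invariant probability, and φ is onto.

Off a null set invariant under π(ℤ^A), a position determines its letter, hence the next position,
hence the whole word; there g is injective (`IsPositionMap.injective_of_notMem_singularSet`). The
domain exchange preserves Lebesgue measure because the translated pieces cover the tile
(`measurePreserving_domainExchange`). Carrying this measure back through g gives μ, and unique
ergodicity of T yields φ_*μ = Haar with no computation of volumes in the quotient.

Almost every fibre of φ corresponds to the points of the tile above y, which are finite in number.
Since S maps fibres onto fibres, their cardinality cannot grow along T, so ergodicity makes it
constant. If the translates of the tile do not overlap, φ is injective above almost every point; as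
every invariant probability projects to Haar measure, it is then determined by it. -/

noncomputable section

/-! ### Minimal systems and bounded cocycles -/

/-- A closed forward invariant nonempty subset of a minimal system is the whole space. -/
theorem IsMinimalSystem.eq_univ_of_isClosed {X : Type*} [TopologicalSpace X] {S : X → X}
    (hmin : IsMinimalSystem S) {s : Set X} (hs : IsClosed s) (hne : s.Nonempty)
    (hinv : MapsTo S s s) : s = univ := by
  obtain ⟨x, hx⟩ := hne
  refine eq_univ_of_univ_subset ?_
  rw [← (hmin x).closure_eq]
  refine closure_minimal ?_ hs
  rintro _ ⟨n, rfl⟩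
  exact hinv.iterate n hx

theorem IsMinimalSystem.surjective {X : Type*} [TopologicalSpace X] [CompactSpace X] [T2Space X]
    {S : X → X} (hmin : IsMinimalSystem S) (hS : Continuous S) : Function.Surjective S := by
  intro y
  have h := hmin.eq_univ_of_isClosed (isCompact_range hS).isClosed ⟨S y, mem_range_self y⟩
    fun x _ => mem_range_self x
  exact mem_range.1 (h.symm ▸ mem_univ y : y ∈ range S)

/-- Among the nonempty closed invariant subsets of a compact invariant set there is a minimal
one. -/
theorem exists_minimal_closed_invariant {Z : Type*} [TopologicalSpace Z] {F : Z → Z} {K : Set Z}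
    (hK : IsCompact K) (hKc : IsClosed K) (hKne : K.Nonempty) (hKF : MapsTo F K K) :
    ∃ M ⊆ K, IsClosed M ∧ M.Nonempty ∧ MapsTo F M M ∧
      ∀ N ⊆ M, IsClosed N → N.Nonempty → MapsTo F N N → N = M := by
  obtain ⟨M, hMK, hM⟩ := zorn_superset_nonempty
    {s : Set Z | s ⊆ K ∧ IsClosed s ∧ s.Nonempty ∧ MapsTo F s s} (fun c hc hchain hcne => by
      refine ⟨⋂₀ c, ⟨?_, isClosed_sInter fun s hs => (hc hs).2.1, ?_, ?_⟩,
        fun s hs => sInter_subset_of_mem hs⟩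
      · obtain ⟨s, hs⟩ := hcne
        exact (sInter_subset_of_mem hs).trans (hc hs).1
      · have : Nonempty c := hcne.to_subtype
        rw [sInter_eq_iInter]
        refine IsCompact.nonempty_iInter_of_directed_nonempty_isCompact_isClosed _ ?_
          (fun s => (hc s.2).2.2.1) (fun s => hK.of_isClosed_subset (hc s.2).2.1 (hc s.2).1)
          (fun s => (hc s.2).2.1)
        intro s t
        rcases hchain.total s.2 t.2 with h | h
        · exact ⟨s, Subset.rfl, h⟩
        · exact ⟨t, h, Subset.rfl⟩
      · intro x hx s hs
        exact (hc hs).2.2.2 (hx s hs)) K ⟨Subset.rfl, hKc, hKne, hKF⟩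
  refine ⟨M, hMK, hM.1.2.1, hM.1.2.2.1, hM.1.2.2.2, fun N hNM hN hne hNF => ?_⟩
  exact hNM.antisymm (hM.2 ⟨hNM.trans hMK, hN, hne, hNF⟩ hNM)

/-- Gottschalk–Hedlund: over a minimal system, a continuous cocycle with a bounded orbit is a
coboundary. -/
theorem IsMinimalSystem.exists_continuous_coboundary {X E : Type*} [TopologicalSpace X]
    [CompactSpace X] [T2Space X] [NormedAddCommGroup E] [NormedSpace ℝ E] [ProperSpace E]
    {S : X → X} (hmin : IsMinimalSystem S) (hS : Continuous S) {f : X → E} (hf : Continuous f)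
    (x₀ : X) {c : ℕ → E} (hc : ∀ n, c (n + 1) = c n + f (S^[n] x₀))
    (hb : Bornology.IsBounded (range c)) :
    ∃ g : X → E, Continuous g ∧ ∀ x, g (S x) = g x + f x := by
  -- The skew product accumulates `f` in the second coordinate, and (S^n x₀, c n) is one of its
  -- orbits. The graph of the desired function is a minimal invariant set inside the compact closure
  -- of that orbit.
  let F : X × E → X × E := fun p => (S p.1, p.2 + f p.1)
  have hF : Continuous F := by fun_prop
  let K : Set (X × E) := closure (range fun n => (S^[n] x₀, c n))
  have hKsub : K ⊆ univ ×ˢ closure (range c) := by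
    refine closure_minimal ?_ (isClosed_univ.prod isClosed_closure)
    rintro _ ⟨n, rfl⟩
    exact ⟨mem_univ _, subset_closure (mem_range_self n)⟩
  have hcl : IsCompact (closure (range c)) := hb.isCompact_closure
  have hK : IsCompact K := (isCompact_univ.prod hcl).of_isClosed_subset isClosed_closure hKsub
  have hKF : MapsTo F K K := by
    refine MapsTo.closure ?_ hF
    rintro _ ⟨n, rfl⟩
    exact ⟨n + 1, by simp only [F, hc, Function.iterate_succ_apply']⟩
  obtain ⟨M, hMK, hMc, hMne, hMF, hMmin⟩ := exists_minimal_closed_invariant hK isClosed_closure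
    ((range_nonempty _).closure) hKF
  have hMcomp : IsCompact M := hK.of_isClosed_subset hMc hMK
  have hfst : Prod.fst '' M = univ := by
    refine hmin.eq_univ_of_isClosed (hMcomp.image continuous_fst).isClosed (hMne.image _) ?_
    rintro _ ⟨p, hp, rfl⟩
    exact ⟨F p, hMF hp, rfl⟩
  have huniq : ∀ x s t, (x, s) ∈ M → (x, t) ∈ M → s = t := by
    intro x s t hs ht
    set δ := t - s with hδ
    -- Vertical translation by δ commutes with `F`, so M ∩ (M − δ) is closed and invariant; it
    -- contains (x, s), hence equals M. Iterating puts every s + nδ in a bounded set, which forces δ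
    -- = 0.
    have hN : {p : X × E | p ∈ M ∧ (p.1, p.2 + δ) ∈ M} = M := by
      refine hMmin _ (fun p hp => hp.1) ?_ ⟨(x, s), hs, ?_⟩ ?_
      · exact hMc.inter (hMc.preimage (f := fun p : X × E => (p.1, p.2 + δ)) (by fun_prop))
      · simpa [hδ] using ht
      · rintro p ⟨hp, hp'⟩
        refine ⟨hMF hp, ?_⟩
        have := hMF hp'
        simp only [F] at this ⊢
        rwa [add_right_comm]
    have hn : ∀ n : ℕ, (x, s + n • δ) ∈ M := by
      intro n
      induction n with
      | zero => simpa using hs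
      | succ n ih =>
        rw [← hN] at ih
        have := ih.2
        rwa [add_assoc, ← succ_nsmul] at this
    obtain ⟨C, hC⟩ := hcl.isBounded.exists_norm_le
    have hδ0 : ‖δ‖ ≤ 0 := by
      by_contra! hpos
      obtain ⟨n, hn'⟩ := exists_nat_gt ((C + ‖s‖) / ‖δ‖)
      rw [div_lt_iff₀ hpos] at hn'
      have h1 := hC _ (hKsub (hMK (hn n))).2
      have h2 : ‖n • δ‖ = n * ‖δ‖ := by
        rw [← Nat.cast_smul_eq_nsmul ℝ, norm_smul, Real.norm_natCast]
      have h3 : ‖n • δ‖ ≤ ‖s + n • δ‖ + ‖s‖ := by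
        simpa using norm_sub_le (s + n • δ) s
      simp only at h1
      linarith
    exact (sub_eq_zero.1 (norm_le_zero_iff.1 hδ0)).symm
  have : CompactSpace M := isCompact_iff_compactSpace.1 hMcomp
  -- M meets each vertical fibre exactly once. Its projection to X is a continuous bijection from a
  -- compact space to a Hausdorff one, so the inverse, and with it the second coordinate, is
  -- continuous.
  let e : M ≃ X := Equiv.ofBijective (fun p => p.1.1) ⟨fun p q hpq => by
      refine Subtype.ext (Prod.ext hpq (huniq q.1.1 _ _ ?_ q.2))
      have := p.2
      simp only at hpq
      rwa [← hpq], fun x => by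
      obtain ⟨p, hp, rfl⟩ := hfst.symm ▸ mem_univ x
      exact ⟨⟨p, hp⟩, rfl⟩⟩
  let h : M ≃ₜ X := Continuous.homeoOfEquivCompactToT2 (f := e)
    (continuous_fst.comp continuous_subtype_val)
  have hsymm : ∀ x, (h.symm x).1.1 = x := fun x => h.apply_symm_apply x
  refine ⟨fun x => (h.symm x).1.2, by fun_prop, fun x => ?_⟩
  refine huniq (S x) _ _ ?_ ?_
  · convert (h.symm (S x)).2 using 1
    exact Prod.ext (hsymm _).symm rfl
  · convert hMF (h.symm x).2 using 1
    simp only [F, hsymm]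

/-! ### Rotations of compact groups -/

/-- A finite measure invariant under a rotation with dense orbits is invariant under all
translations. -/
theorem isAddLeftInvariant_of_denseRange_zsmul {G : Type*} [AddCommGroup G] [TopologicalSpace G]
    [IsTopologicalAddGroup G] [CompactSpace G] [T2Space G] [SecondCountableTopology G]
    [MeasurableSpace G] [BorelSpace G] {α : G} (hα : DenseRange fun n : ℤ => n • α)
    (ν : Measure G) [IsFiniteMeasure ν] (hν : MeasurePreserving (fun x => x + α) ν ν) :
    ν.IsAddLeftInvariant := by
  have hmeas : ∀ t : G, Measurable fun x : G => x + t := fun t => measurable_add_const t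
  have hneg : MeasurePreserving (fun x => x + -α) ν ν := by
    refine ⟨hmeas _, ?_⟩
    conv_lhs => rw [← hν.map_eq]
    rw [Measure.map_map (hmeas _) (hmeas _)]
    simp [Function.comp_def]
  have hint : ∀ n : ℤ, MeasurePreserving (fun x => x + n • α) ν ν := by
    intro n
    induction n using Int.induction_on with
    | zero =>
      simp only [zero_smul, add_zero]
      exact MeasurePreserving.id ν
    | succ n ih =>
      have := hν.comp ih
      simpa [Function.comp_def, add_smul, add_assoc] using this
    | pred n ih =>
      have := hneg.comp ih
      have h : (-(n : ℤ) - 1) • α = -(n : ℤ) • α + -α := by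
        rw [sub_smul, one_smul, sub_eq_add_neg]
      simp only [h, ← add_assoc]
      exact this
  refine ⟨fun t => ?_⟩
  simp_rw [add_comm t]
  have : IsFiniteMeasure (Measure.map (fun x => x + t) ν) := inferInstance
  let := TopologicalSpace.metrizableSpaceMetric G
  refine ext_of_forall_integral_eq_of_IsFiniteMeasure fun f => ?_
  rw [integral_map (hmeas t).aemeasurable f.continuous.aestronglyMeasurable]
  -- The integral of a translate of `f` is continuous in t and constant on the dense set of
  -- multiples of α, hence constant.
  have hcont : Continuous fun t : G => ∫ x, f (x + t) ∂ν := by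
    have := continuous_parametric_integral_of_continuous (μ := ν) (s := univ)
      (f := fun t x : G => f (x + t)) (by fun_prop) isCompact_univ
    simpa using this
  refine congrFun (hα.equalizer hcont continuous_const ?_) t
  funext n
  simp only [Function.comp]
  have h1 := (hint n).map_eq
  conv_rhs => rw [← h1]
  rw [integral_map (hmeas _).aemeasurable f.continuous.aestronglyMeasurable]

/-- A rotation of a compact group with dense orbits is uniquely ergodic. -/
theorem eq_addHaar_of_measurePreserving_add {G : Type*} [AddCommGroup G] [TopologicalSpace G]
    [IsTopologicalAddGroup G] [CompactSpace G] [T2Space G] [SecondCountableTopology G]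
    [MeasurableSpace G] [BorelSpace G] {α : G} (hα : DenseRange fun n : ℤ => n • α)
    (m : Measure G) [IsProbabilityMeasure m] [m.IsAddHaarMeasure]
    (ν : Measure G) [IsProbabilityMeasure ν] (hν : MeasurePreserving (fun x => x + α) ν ν) :
    ν = m := by
  have := isAddLeftInvariant_of_denseRange_zsmul hα ν hν
  have : ν.IsAddHaarMeasure := by
    refine Measure.isAddHaarMeasure_of_isCompact_nonempty_interior ν univ isCompact_univ
      (by simp) (by simp) (by simp)
  exact Measure.isAddHaarMeasure_eq_of_isProbabilityMeasure ν m

/-! ### Measurable sections -/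

/-- A continuous map on a compact space which is bijective above a measurable set has a measurable
inverse there. -/
theorem exists_measurable_section {X Y : Type*} [TopologicalSpace X] [CompactSpace X]
    [MeasurableSpace X] [BorelSpace X] [Nonempty X] [TopologicalSpace Y] [T2Space Y]
    [MeasurableSpace Y] [BorelSpace Y] {g : X → Y} (hg : Continuous g) {N : Set Y}
    (hN : MeasurableSet N) (hsurj : ∀ y ∉ N, ∃ x, g x = y)
    (hinj : ∀ x x', g x ∉ N → g x = g x' → x = x') :
    ∃ ψ : Y → X, Measurable ψ ∧ (∀ y ∉ N, g (ψ y) = y) ∧ ∀ x, g x ∉ N → ψ (g x) = x := by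
  classical
  choose! s hs using hsurj
  have hsg : ∀ x, g x ∉ N → s (g x) = x := fun x hx =>
    (hinj x _ hx (hs _ hx).symm).symm
  let x₀ : X := Classical.arbitrary X
  refine ⟨fun y => if y ∈ N then x₀ else s y, ?_, fun y hy => by simp [hy, hs],
    fun x hx => by simp [hx, hsg]⟩
  refine measurable_of_isClosed fun C hC => ?_
  -- Off N the preimage of a closed set C under the section is g(C), which is compact.
  have : (fun y => if y ∈ N then x₀ else s y) ⁻¹' C
      = (N ∩ {y | x₀ ∈ C}) ∪ (g '' C ∩ Nᶜ) := by
    ext y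
    by_cases hy : y ∈ N
    · simp [hy]
    · simp only [mem_preimage, hy, if_false, mem_union, mem_inter_iff, false_and, false_or,
        mem_compl_iff, not_false_eq_true, and_true]
      constructor
      · exact fun h => ⟨s y, h, hs y hy⟩
      · rintro ⟨x, hx, rfl⟩
        rwa [hsg x hy]
  rw [this]
  exact (hN.inter (MeasurableSet.const _)).union
    ((hC.isCompact.image hg).isClosed.measurableSet.inter hN.compl)

/-! ### Fibre cardinalities -/

/-- A measurable function with values in the positive integers that does not increase along an
ergodic map is almost everywhere constant. -/
theorem Ergodic.exists_ae_eq_natCast {Y : Type*} [MeasurableSpace Y] {T : Y → Y} {m : Measure Y}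
    [IsProbabilityMeasure m] (hT : Ergodic T m) {c : Y → ℕ∞}
    (hmeas : ∀ k : ℕ, NullMeasurableSet {y | (k : ℕ∞) ≤ c y} m) (hle : ∀ y, c (T y) ≤ c y)
    (hpos : ∀ y, 1 ≤ c y) (hfin : ∀ᵐ y ∂m, c y ≠ ⊤) :
    ∃ k : ℕ, 1 ≤ k ∧ ∀ᵐ y ∂m, c y = k := by
  have hdich : ∀ k : ℕ, (∀ᵐ y ∂m, ¬ (k : ℕ∞) ≤ c y) ∨ ∀ᵐ y ∂m, (k : ℕ∞) ≤ c y := by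
    intro k
    rcases hT.ae_empty_or_univ_of_preimage_ae_le (hmeas k)
      (Filter.Eventually.of_forall fun y (hy : (k : ℕ∞) ≤ c (T y)) => hy.trans (hle y)) with h | h
    · exact Or.inl (measure_eq_zero_iff_ae_notMem.1 (ae_eq_empty.1 h))
    · exact Or.inr (Filter.eventuallyEq_univ.1 h)
  have hex : ∃ k : ℕ, ¬ ∀ᵐ y ∂m, (k : ℕ∞) ≤ c y := by
    by_contra! hall
    obtain ⟨y, hy, hy'⟩ := ((ae_all_iff.2 hall).and hfin).exists
    exact hy' (ENat.eq_top_iff_forall_ge.2 hy)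
  classical
  -- This is the first level not reached almost everywhere. By the dichotomy it is missed almost
  -- everywhere, so the constant value is k − 1.
  set k := Nat.find hex with hk
  have hk1 := Nat.find_spec hex
  rw [← hk] at hk1
  have hk0 : k ≠ 0 := by
    intro h0
    rw [h0] at hk1
    exact hk1 (by simp)
  have hk2 : k ≠ 1 := by
    intro h0
    rw [h0] at hk1
    exact hk1 (by simpa using Filter.Eventually.of_forall hpos)
  have hpred := Nat.find_min hex (m := k - 1) (by omega)
  rw [not_not] at hpred
  refine ⟨k - 1, by omega, ?_⟩
  filter_upwards [hpred, (hdich k).resolve_right hk1] with y h1 h2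
  refine le_antisymm ?_ h1
  have : k = (k - 1) + 1 := by omega
  rw [this] at h2
  push_cast at h2
  exact ENat.lt_add_one_iff (ENat.natCast_ne_top _) |>.1 (not_le.1 h2)

/-- The set of points with at least `k` preimages in a compact set is measurable, for a
homomorphism with countable kernel. -/
theorem measurableSet_le_encard_inter_fiber {E G : Type*} [AddCommGroup E] [TopologicalSpace E]
    [IsTopologicalAddGroup E] [T2Space E] [AddCommGroup G] [TopologicalSpace G] [T2Space G]
    [MeasurableSpace G] [BorelSpace G] {p : E →+ G} (hp : Continuous p)
    (hker : (p.ker : Set E).Countable) {R : Set E} (hR : IsCompact R) (k : ℕ) :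
    MeasurableSet {y | (k : ℕ∞) ≤ (R ∩ p ⁻¹' {y}).encard} := by
  rcases Nat.eq_zero_or_pos k with rfl | hk
  · simp
  have : Countable p.ker := hker.to_subtype
  -- A fibre is a coset of the countable kernel, so k points in it amount to one base point and k
  -- distinct kernel elements. This gives a countable union of images of compact sets; k > 0 is
  -- needed for their compactness.
  have key : {y | (k : ℕ∞) ≤ (R ∩ p ⁻¹' {y}).encard} =
      ⋃ s : Finset p.ker, ⋃ (_ : s.card = k), p '' {x | ∀ γ ∈ s, x + (γ : E) ∈ R} := by
    ext y
    simp only [mem_ofPred, mem_iUnion, mem_image, exists_prop]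
    constructor
    · intro h
      obtain ⟨t, ht, htk⟩ := exists_subset_encard_eq h
      have htf : t.Finite := finite_of_encard_eq_coe htk
      obtain ⟨x, hx⟩ : t.Nonempty := by
        rw [← encard_pos, htk]
        exact_mod_cast hk
      have hxy : p x = y := (ht hx).2
      classical
      let f : E → p.ker := fun z => if h : p (z - x) = 0 then ⟨z - x, h⟩ else 0
      have hf : ∀ z ∈ t, (f z : E) = z - x := by
        intro z hz
        have : p (z - x) = 0 := by rw [map_sub, hxy, (ht hz).2, sub_self]
        simp only [f, dif_pos this]
      refine ⟨htf.toFinset.image f, ?_, x, ?_, hxy⟩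
      · rw [Finset.card_image_of_injOn]
        · rw [htf.encard_eq_coe_toFinset_card] at htk
          exact_mod_cast htk
        · intro a ha b hb hab
          have := congrArg (Subtype.val) hab
          rw [hf a (by simpa using ha), hf b (by simpa using hb)] at this
          exact sub_left_injective this
      · intro γ hγ
        obtain ⟨z, hz, rfl⟩ := Finset.mem_image.1 hγ
        have hz' : z ∈ t := by simpa using hz
        rw [hf z hz', add_sub_cancel]
        exact (ht hz').1
    · rintro ⟨s, rfl, x, hx, rfl⟩
      have hsub : (fun γ : p.ker => x + (γ : E)) '' (s : Set p.ker) ⊆ R ∩ p ⁻¹' {p x} := by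
        rintro _ ⟨γ, hγ, rfl⟩
        refine ⟨hx γ hγ, ?_⟩
        have : p γ = 0 := γ.2
        simp [this]
      refine le_trans (le_of_eq ?_) (encard_le_encard hsub)
      rw [InjOn.encard_image, encard_coe_eq_coe_finsetCard]
      intro a _ b _ hab
      exact Subtype.ext (add_left_cancel hab)
  rw [key]
  refine MeasurableSet.iUnion fun s => MeasurableSet.iUnion fun hs => ?_
  refine IsCompact.measurableSet (IsCompact.image ?_ hp)
  obtain ⟨γ₀, hγ₀⟩ : s.Nonempty := Finset.card_pos.1 (hs ▸ hk)
  have h0 : IsCompact ((fun x => x + (γ₀ : E)) ⁻¹' R) :=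
    (Homeomorph.addRight (γ₀ : E)).isCompact_preimage.2 hR
  refine h0.of_isClosed_subset ?_ fun x hx => hx γ₀ hγ₀
  simp only [ofPred_forall]
  exact isClosed_iInter fun γ => isClosed_iInter fun _ =>
    hR.isClosed.preimage (by fun_prop)

theorem IsSigmaCompact.measurableSet {Y : Type*} [TopologicalSpace Y] [T2Space Y]
    [MeasurableSpace Y] [BorelSpace Y] {s : Set Y} (hs : IsSigmaCompact s) : MeasurableSet s := by
  obtain ⟨K, hK, rfl⟩ := hs
  exact MeasurableSet.iUnion fun n => (hK n).measurableSet

/-! ### Measure preservation from covering -/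

/-- A measurable self-map of a finite measure space under which preimages do not lose measure is
measure preserving. -/
theorem measurePreserving_of_le_measure_preimage {Y : Type*} [MeasurableSpace Y] {E : Y → Y}
    {m : Measure Y} [IsFiniteMeasure m] (hE : Measurable E)
    (h : ∀ s, MeasurableSet s → m s ≤ m (E ⁻¹' s)) : MeasurePreserving E m m := by
  refine ⟨hE, (Measure.eq_of_le_of_measure_univ_eq (Measure.le_iff.2 fun s hs => ?_) ?_).symm⟩
  · rw [Measure.map_apply hE hs]
    exact h s hs
  · rw [Measure.map_apply hE MeasurableSet.univ, preimage_univ]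

/-- Transport of a measure by an almost everywhere defined measurable section: the section and the
map are inverse isomorphisms. -/
theorem measurePreserving_of_section {X Y : Type*} [MeasurableSpace X] [MeasurableSpace Y]
    {g : X → Y} {ψ : Y → X} (hg : Measurable g) (hψ : Measurable ψ) {m : Measure Y}
    (h : ∀ᵐ y ∂m, g (ψ y) = y) : MeasurePreserving g (m.map ψ) m := by
  refine ⟨hg, ?_⟩
  rw [Measure.map_map hg hψ, Measure.map_congr (show g ∘ ψ =ᵐ[m] id from h), Measure.map_id]

/-- Pullback of an almost everywhere injective system: if `φ` has a section `ψ` off a null set and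
intertwines `S` and `T`, then `S` preserves the transported measure. -/
theorem MeasurePreserving.of_section {X Y : Type*} [MeasurableSpace X] [MeasurableSpace Y]
    {S : X → X} {T : Y → Y} {g : X → Y} {ψ : Y → X} {m : Measure Y} {N : Set Y} (hN : m N = 0)
    (hS : Measurable S) (hψ : Measurable ψ)
    (hgψ : ∀ y ∉ N, g (ψ y) = y) (hψg : ∀ x, g x ∉ N → ψ (g x) = x)
    (hT : MeasurePreserving T m m) (hST : ∀ x, g x ∉ N → g (S x) = T (g x)) :
    MeasurePreserving S (m.map ψ) (m.map ψ) := by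
  refine ⟨hS, ?_⟩
  have hNae : ∀ᵐ y ∂m, y ∉ N := measure_eq_zero_iff_ae_notMem.1 hN
  have hcongr : S ∘ ψ =ᵐ[m] ψ ∘ T := by
    filter_upwards [hNae, hT.quasiMeasurePreserving.ae hNae] with y hy hTy
    have h1 : g (S (ψ y)) = T y := by
      rw [hST _ (by rwa [hgψ y hy]), hgψ y hy]
    rw [Function.comp_apply, Function.comp_apply, ← h1, hψg _ (by rwa [h1])]
  rw [Measure.map_map hS hψ, Measure.map_congr hcongr, ← Measure.map_map hψ hT.measurable,
    hT.map_eq]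

/-! ### Prefixes of an infinite word -/

section Words

variable {A : Type*}

theorem wordPrefix_succ (u : ℕ → A) (n : ℕ) :
    wordPrefix u (n + 1) = wordPrefix u n ++ [u n] := by
  simp [wordPrefix, List.range_succ]

theorem shift_iterate_apply (u : ℕ → A) (n i : ℕ) : (shift^[n] u) i = u (i + n) := by
  induction n generalizing u with
  | zero => simp
  | succ n ih =>
    rw [Function.iterate_succ_apply, ih]
    simp only [shift]
    congr 1

variable [DecidableEq A]

theorem abelianVector_wordPrefix_succ (u : ℕ → A) (n : ℕ) :
    abelianVector (wordPrefix u (n + 1)) = abelianVector (wordPrefix u n) + basisVec (u n) := by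
  rw [wordPrefix_succ, abelianVector_append_singleton]

theorem mem_discretePiece {u : ℕ → A} {a : A} {x : A → ℤ} :
    x ∈ discretePiece u a ↔ ∃ n, u n = a ∧ x = abelianVector (wordPrefix u n) := by
  constructor
  · rintro ⟨v, n, hv, rfl⟩
    cases n with
    | zero => simp [wordPrefix] at hv
    | succ n =>
      rw [wordPrefix_succ] at hv
      obtain ⟨rfl, h⟩ := List.append_inj' hv rfl
      exact ⟨n, by simpa using h.symm, rfl⟩
  · rintro ⟨n, rfl, rfl⟩
    exact ⟨_, n + 1, (wordPrefix_succ u n).symm, rfl⟩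

theorem discreteLine_eq_range (u : ℕ → A) :
    discreteLine u = range fun n => abelianVector (wordPrefix u n) := by
  ext x
  simp [discreteLine, eq_comm]

theorem sum_basisVec [Fintype A] (a : A) : ∑ b, basisVec a b = 1 := by
  simp [basisVec]

theorem sum_abelianVector_wordPrefix [Fintype A] (u : ℕ → A) (n : ℕ) :
    ∑ b, abelianVector (wordPrefix u n) b = n := by
  induction n with
  | zero => simp [wordPrefix, abelianVector]
  | succ n ih =>
    rw [abelianVector_wordPrefix_succ]
    simp only [Pi.add_apply, Finset.sum_add_distrib, ih, sum_basisVec]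
    push_cast
    ring

end Words

/-! ### The lattice `π(Γ₀)` -/

section Lattice

variable {A : Type*} [DecidableEq A] {P : Submodule ℝ (EuclideanSpace ℝ A)}
  {π : EuclideanSpace ℝ A →ₗ[ℝ] P}

theorem intProj_basisVec (a : A) : intProj π (basisVec a) = π (EuclideanSpace.single a 1) := by
  simp only [intProj, AddMonoidHom.coe_mk, ZeroHom.coe_mk]
  congr 1
  ext b
  simp [basisVec, Pi.single_apply]

variable [Fintype A]

theorem intProj_eq_sum (z : A → ℤ) : intProj π z = ∑ a, z a • intProj π (basisVec a) := by
  rw [← Fintype.sum_congr _ _ fun a => map_zsmul (intProj π) (z a) (basisVec a), ← map_sum]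
  congr 1
  ext b
  simp [basisVec, Pi.single_apply, Finset.sum_apply]

/-- The sum of the coordinates. -/
def coordSum (A : Type*) [Fintype A] : EuclideanSpace ℝ A →ₗ[ℝ] ℝ where
  toFun x := ∑ a, x a
  map_add' x y := by simp [Finset.sum_add_distrib]
  map_smul' c x := by simp [Finset.mul_sum]

/-- If `π(D_u)` is bounded, the kernel of `π` is not contained in the hyperplane of vectors with
zero coordinate sum. -/
theorem exists_ker_coordSum_ne_zero {u : ℕ → A} (hπ : ∀ x : P, π x = x)
    (hbdd : Bornology.IsBounded (intProj π '' discreteLine u)) :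
    ∃ w, π w = 0 ∧ coordSum A w ≠ 0 := by
  by_contra! h
  -- Otherwise the coordinate sum factors through π and is bounded on π(D_u), yet it equals n on the
  -- prefix of length n.
  have hfac : ∀ x, coordSum A x = coordSum A (π x : EuclideanSpace ℝ A) := by
    intro x
    have := h (x - (π x : EuclideanSpace ℝ A)) (by rw [map_sub, hπ, sub_self])
    rw [map_sub] at this
    linarith
  let ℓ : P →ₗ[ℝ] ℝ := (coordSum A).comp P.subtype
  have hb := (LinearMap.toContinuousLinearMap ℓ).lipschitz.isBounded_image hbdd
  obtain ⟨C, hC⟩ := hb.exists_norm_le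
  obtain ⟨n, hn⟩ := exists_nat_gt C
  have hmem : intProj π (abelianVector (wordPrefix u n)) ∈ intProj π '' discreteLine u :=
    ⟨_, ⟨n, rfl⟩, rfl⟩
  have h1 := hC _ ⟨_, hmem, rfl⟩
  have h2 : ℓ (intProj π (abelianVector (wordPrefix u n))) = n := by
    simp only [ℓ, intProj, LinearMap.comp_apply, Submodule.subtype_apply, AddMonoidHom.coe_mk,
      ZeroHom.coe_mk]
    rw [← hfac]
    simp only [coordSum, LinearMap.coe_mk, AddHom.coe_mk]
    exact_mod_cast sum_abelianVector_wordPrefix u n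
  rw [LinearMap.coe_toContinuousLinearMap', h2, Real.norm_natCast] at h1
  linarith

/-- `π(Γ₀)` is the lattice spanned by a basis of the hyperplane. -/
theorem exists_basis_projGamma0 {u : ℕ → A} (hP : Module.finrank ℝ P + 1 = Fintype.card A)
    (hπ : ∀ x : P, π x = x) (hbdd : Bornology.IsBounded (intProj π '' discreteLine u)) (a₀ : A) :
    ∃ b : Module.Basis {a : A // a ≠ a₀} ℝ P,
      projGamma0 π = (Submodule.span ℤ (range b)).toAddSubgroup := by
  obtain ⟨w, hw, hw0⟩ := exists_ker_coordSum_ne_zero hπ hbdd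
  let f : {a : A // a ≠ a₀} → P := fun a =>
    intProj π (basisVec a.1) - intProj π (basisVec a₀)
  have hspan : ⊤ ≤ Submodule.span ℝ (range f) := by
    intro p _
    -- Subtracting a multiple of the kernel vector `w` makes the coordinate sum vanish without
    -- changing the projection; then x = Σ x_a (e_a − e_{a₀}).
    set x : EuclideanSpace ℝ A := p - (coordSum A p / coordSum A w) • w with hx
    have hpx : π x = p := by rw [hx, map_sub, map_smul, hw, smul_zero, sub_zero, hπ]
    have hsx : ∑ a, x a = 0 := by
      have : coordSum A x = 0 := by
        rw [hx, map_sub, map_smul, smul_eq_mul, div_mul_cancel₀ _ hw0, sub_self]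
      simpa [coordSum] using this
    have hsum : p = ∑ a, x a • (intProj π (basisVec a) - intProj π (basisVec a₀)) := by
      simp_rw [smul_sub]
      rw [Finset.sum_sub_distrib, ← Finset.sum_smul, hsx, zero_smul, sub_zero]
      simp_rw [intProj_basisVec, ← map_smul]
      rw [← map_sum, ← hpx]
      congr 1
      ext b
      simp [Finset.sum_apply, Pi.single_apply]
    rw [hsum]
    refine Submodule.sum_mem _ fun a _ => Submodule.smul_mem _ _ ?_
    by_cases ha : a = a₀
    · rw [ha, sub_self]
      exact Submodule.zero_mem _
    · exact Submodule.subset_span ⟨⟨a, ha⟩, rfl⟩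
  have hcard : Fintype.card {a : A // a ≠ a₀} = Module.finrank ℝ P := by
    rw [Fintype.card_subtype_compl, Fintype.card_subtype_eq]
    omega
  refine ⟨basisOfTopLeSpanOfCardEqFinrank f hspan hcard, ?_⟩
  rw [coe_basisOfTopLeSpanOfCardEqFinrank, Submodule.span_int_eq_addSubgroupClosure]
  rw [projGamma0, Gamma0, AddMonoidHom.map_closure]
  refine le_antisymm ((AddSubgroup.closure_le _).2 ?_) ((AddSubgroup.closure_le _).2 ?_)
  · rintro _ ⟨_, ⟨a, b, rfl⟩, rfl⟩
    have hmem : ∀ a, intProj π (basisVec a) - intProj π (basisVec a₀) ∈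
        AddSubgroup.closure (range f) := by
      intro a
      by_cases ha : a = a₀
      · rw [ha, sub_self]
        exact AddSubgroup.zero_mem _
      · exact AddSubgroup.subset_closure ⟨⟨a, ha⟩, rfl⟩
    have := AddSubgroup.sub_mem _ (hmem a) (hmem b)
    rwa [sub_sub_sub_cancel_right, ← map_sub] at this
  · rintro _ ⟨a, rfl⟩
    exact AddSubgroup.subset_closure ⟨_, ⟨a.1, a₀, rfl⟩, map_sub _ _ _⟩

end Lattice

/-! ### The torus `P / π(Γ₀)` -/

section Torus

variable {A : Type*} [DecidableEq A] {P : Submodule ℝ (EuclideanSpace ℝ A)}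
  (π : EuclideanSpace ℝ A →ₗ[ℝ] P)

theorem continuous_torusMk : Continuous (torusMk π) := continuous_quot_mk

theorem surjective_torusMk : Function.Surjective (torusMk π) :=
  QuotientAddGroup.mk'_surjective (projGamma0 π)

theorem isOpenMap_torusMk [Fintype A] : IsOpenMap (torusMk π) :=
  QuotientAddGroup.isOpenMap_coe

theorem ker_torusMk : (torusMk π).ker = projGamma0 π := QuotientAddGroup.ker_mk' (projGamma0 π)

theorem torusMk_eq_zero {x : P} : torusMk π x = 0 ↔ x ∈ projGamma0 π := by
  rw [← AddMonoidHom.mem_ker, ker_torusMk]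

instance [Fintype A] : SecondCountableTopology (ProjTorus π) :=
  (isOpenMap_torusMk π).isQuotientMap (continuous_torusMk π) (surjective_torusMk π)
    |>.secondCountableTopology (isOpenMap_torusMk π)

variable {π}

theorem torusMk_basisVec (a b : A) :
    torusMk π (intProj π (basisVec a)) = torusMk π (intProj π (basisVec b)) := by
  rw [← sub_eq_zero, ← map_sub, torusMk_eq_zero, ← map_sub]
  exact ⟨_, AddSubgroup.subset_closure ⟨a, b, rfl⟩, rfl⟩

variable [Fintype A]

theorem torusMk_intProj (a : A) (z : A → ℤ) :
    torusMk π (intProj π z) = (∑ b, z b) • torusMk π (intProj π (basisVec a)) := by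
  rw [intProj_eq_sum, map_sum, Finset.sum_smul]
  refine Finset.sum_congr rfl fun b _ => ?_
  rw [map_zsmul, torusMk_basisVec b a]

/-- All π(e_a) have the same class in the torus, so the image of ℤ^A there consists of the multiples
of one element. -/
theorem denseRange_zsmul_torusMk (hdense : DenseRange (intProj π)) (a : A) :
    DenseRange fun n : ℤ => n • torusMk π (intProj π (basisVec a)) := by
  have h := (surjective_torusMk π).denseRange.comp hdense (continuous_torusMk π)
  refine h.mono ?_
  rintro _ ⟨z, rfl⟩
  exact ⟨∑ b, z b, (torusMk_intProj a z).symm⟩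

variable {u : ℕ → A}

theorem isClosed_projGamma0 (hP : Module.finrank ℝ P + 1 = Fintype.card A)
    (hπ : ∀ x : P, π x = x) (hbdd : Bornology.IsBounded (intProj π '' discreteLine u)) :
    IsClosed (projGamma0 π : Set P) := by
  obtain ⟨b, hb⟩ := exists_basis_projGamma0 hP hπ hbdd (u 0)
  rw [hb]
  exact AddSubgroup.isClosed_of_discrete

theorem finite_inter_projGamma0 (hP : Module.finrank ℝ P + 1 = Fintype.card A)
    (hπ : ∀ x : P, π x = x) (hbdd : Bornology.IsBounded (intProj π '' discreteLine u))
    {s : Set P} (hs : Bornology.IsBounded s) : (s ∩ projGamma0 π).Finite := by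
  obtain ⟨b, hb⟩ := exists_basis_projGamma0 hP hπ hbdd (u 0)
  rw [hb]
  exact ZSpan.setFinite_inter b hs

theorem t2Space_projTorus (hP : Module.finrank ℝ P + 1 = Fintype.card A)
    (hπ : ∀ x : P, π x = x) (hbdd : Bornology.IsBounded (intProj π '' discreteLine u)) :
    T2Space (ProjTorus π) := by
  have := isClosed_projGamma0 hP hπ hbdd
  exact inferInstanceAs (T2Space (P ⧸ projGamma0 π))

theorem compactSpace_projTorus (hP : Module.finrank ℝ P + 1 = Fintype.card A)
    (hπ : ∀ x : P, π x = x) (hbdd : Bornology.IsBounded (intProj π '' discreteLine u)) :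
    CompactSpace (ProjTorus π) := by
  obtain ⟨b, hb⟩ := exists_basis_projGamma0 hP hπ hbdd (u 0)
  have hK : IsCompact (closure (ZSpan.fundamentalDomain b)) :=
    (ZSpan.fundamentalDomain_isBounded b).isCompact_closure
  have himg : torusMk π '' closure (ZSpan.fundamentalDomain b) = univ := by
    refine eq_univ_of_forall fun y => ?_
    obtain ⟨x, rfl⟩ := surjective_torusMk π y
    refine ⟨ZSpan.fract b x, subset_closure (ZSpan.fract_mem_fundamentalDomain b x), ?_⟩
    rw [ZSpan.fract_apply, map_sub, sub_eq_self, torusMk_eq_zero, hb]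
    exact (ZSpan.floor b x).2
  exact ⟨himg ▸ hK.image (continuous_torusMk π)⟩

theorem countable_projGamma0 : (projGamma0 π : Set P).Countable := by
  rw [projGamma0, AddSubgroup.coe_map]
  exact (to_countable _).image _

/-- The normalised Haar measure of a compact torus is a Haar probability measure. -/
theorem isProbabilityMeasure_torusMeasure [CompactSpace (ProjTorus π)] :
    IsProbabilityMeasure (torusMeasure π) :=
  ⟨by
    rw [torusMeasure, Measure.smul_apply, smul_eq_mul]
    exact ENNReal.inv_mul_cancel (NeZero.ne _) (measure_ne_top _ _)⟩

theorem isAddHaarMeasure_torusMeasure [CompactSpace (ProjTorus π)] :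
    (torusMeasure π).IsAddHaarMeasure :=
  Measure.IsAddHaarMeasure.smul _ (ENNReal.inv_ne_zero.2 (measure_ne_top _ _))
    (ENNReal.inv_ne_top.2 (NeZero.ne _))

end Torus

/-! ### Compactness of the tile -/

section Tile

variable {A : Type*} [DecidableEq A] {P : Submodule ℝ (EuclideanSpace ℝ A)}
  {π : EuclideanSpace ℝ A →ₗ[ℝ] P} {u : ℕ → A}

theorem discretePiece_subset (a : A) : discretePiece u a ⊆ discreteLine u := by
  intro x hx
  obtain ⟨n, -, rfl⟩ := mem_discretePiece.1 hx
  exact ⟨n, rfl⟩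

theorem tilePiece_subset_tile (a : A) : tilePiece π u a ⊆ tile π u :=
  closure_mono (image_mono (discretePiece_subset a))

variable [Fintype A]

theorem isCompact_tile (hbdd : Bornology.IsBounded (intProj π '' discreteLine u)) :
    IsCompact (tile π u) := hbdd.isCompact_closure

theorem isCompact_tilePiece (hbdd : Bornology.IsBounded (intProj π '' discreteLine u)) (a : A) :
    IsCompact (tilePiece π u a) :=
  (isCompact_tile hbdd).of_isClosed_subset isClosed_closure (tilePiece_subset_tile a)

end Tile

/-! ### The position map on the subshift -/

section Position

variable {A : Type*} [TopologicalSpace A] {u : ℕ → A}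

instance [Finite A] : CompactSpace (subshift u) :=
  isCompact_iff_compactSpace.1 isClosed_closure.isCompact

/-- The word `u` as a point of its subshift. -/
def basePoint (u : ℕ → A) : subshift u := ⟨u, subset_closure ⟨0, rfl⟩⟩

instance : Nonempty (subshift u) := ⟨basePoint u⟩

theorem continuous_subshiftMap : Continuous (subshiftMap u) :=
  Continuous.restrict _ continuous_shift

theorem coe_subshiftMap_iterate (x : subshift u) (n : ℕ) :
    ((subshiftMap u)^[n] x : ℕ → A) = shift^[n] (x : ℕ → A) := by
  induction n with
  | zero => rfl
  | succ n ih =>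
    rw [Function.iterate_succ_apply', Function.iterate_succ_apply', ← ih]
    rfl

theorem subshiftMap_iterate_apply_zero (x : subshift u) (n : ℕ) :
    ((subshiftMap u)^[n] x).1 0 = x.1 n := by
  rw [coe_subshiftMap_iterate, shift_iterate_apply, zero_add]

theorem dense_orbit_basePoint : Dense (range fun n : ℕ => (subshiftMap u)^[n] (basePoint u)) := by
  rw [Subtype.dense_iff, ← range_comp]
  refine closure_mono ?_
  rintro _ ⟨n, rfl⟩
  exact ⟨n, coe_subshiftMap_iterate _ _⟩

variable [Fintype A] [DecidableEq A] {P : Submodule ℝ (EuclideanSpace ℝ A)}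

/-- A continuous map `g` from the subshift to the hyperplane sending `Sⁿu` to the projection of the
abelianised prefix of length `n`. -/
structure IsPositionMap (π : EuclideanSpace ℝ A →ₗ[ℝ] P) (u : ℕ → A) (g : subshift u → P) :
    Prop where
  continuous : Continuous g
  apply_orbit : ∀ n, g ((subshiftMap u)^[n] (basePoint u)) =
    intProj π (abelianVector (wordPrefix u n))
  apply_shift : ∀ x, g (subshiftMap u x) = g x + intProj π (basisVec (x.1 0))

variable {π : EuclideanSpace ℝ A →ₗ[ℝ] P}

/-- Gottschalk–Hedlund applies to x ↦ π(e_{x₀}), whose sums along the orbit of `u` are the points of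
π(D_u). -/
theorem exists_isPositionMap [DiscreteTopology A]
    (hbdd : Bornology.IsBounded (intProj π '' discreteLine u))
    (hmin : IsMinimalSystem (subshiftMap u)) : ∃ g, IsPositionMap π u g := by
  have hf : Continuous fun x : subshift u => intProj π (basisVec (x.1 0)) := by
    have h0 : Continuous fun x : subshift u => x.1 0 :=
      (continuous_apply 0).comp continuous_subtype_val
    exact (continuous_of_discreteTopology (f := fun a : A => intProj π (basisVec a))).comp h0
  obtain ⟨g, hg, hgS⟩ := hmin.exists_continuous_coboundary continuous_subshiftMap hf (basePoint u)
    (c := fun n => intProj π (abelianVector (wordPrefix u n)))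
    (fun n => by
      rw [abelianVector_wordPrefix_succ, map_add, subshiftMap_iterate_apply_zero]
      rfl)
    (by rwa [discreteLine_eq_range, ← range_comp] at hbdd)
  -- A coboundary fixes g only up to a constant; this choice places `u` at 0, the projection of the
  -- empty prefix.
  refine ⟨fun x => g x - g (basePoint u), by fun_prop, fun n => ?_, fun x => ?_⟩
  · induction n with
    | zero =>
      have h0 : abelianVector (wordPrefix u 0) = 0 := by ext; simp [wordPrefix, abelianVector]
      rw [h0, map_zero, Function.iterate_zero, id, sub_self]
    | succ n ih =>
      rw [abelianVector_wordPrefix_succ, map_add, ← ih, Function.iterate_succ_apply', hgS,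
        subshiftMap_iterate_apply_zero]
      simp only [basePoint]
      abel
  · simp only [hgS]
    abel

namespace IsPositionMap

variable {g : subshift u → P}

theorem range_eq (hg : IsPositionMap π u g) : range g = tile π u := by
  have hcl : IsClosed (range g) := (isCompact_range hg.continuous).isClosed
  have h1 : intProj π '' discreteLine u =
      g '' range fun n : ℕ => (subshiftMap u)^[n] (basePoint u) := by
    rw [discreteLine_eq_range, ← range_comp, ← range_comp]
    congr 1
    funext n
    exact (hg.apply_orbit n).symm
  refine Subset.antisymm ?_ ?_
  · rw [tile, h1, ← image_univ, ← dense_orbit_basePoint.closure_eq]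
    exact image_closure_subset_closure_image hg.continuous
  · refine closure_minimal ?_ hcl
    rw [h1]
    exact image_subset_range _ _

theorem mem_tile (hg : IsPositionMap π u g) (x : subshift u) : g x ∈ tile π u :=
  hg.range_eq ▸ mem_range_self x

-- The cylinder of words with the first letter of x is open, so x is a limit of shifts of `u`
-- starting with that letter; their positions lie in the projected discrete piece.
omit [Fintype A] in
theorem mem_tilePiece [DiscreteTopology A] (hg : IsPositionMap π u g) (x : subshift u) :
    g x ∈ tilePiece π u (x.1 0) := by
  have hopen : IsOpen {y : subshift u | y.1 0 = x.1 0} := by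
    have h0 : Continuous fun y : subshift u => y.1 0 :=
      (continuous_apply 0).comp continuous_subtype_val
    exact (isOpen_discrete {x.1 0}).preimage h0
  have hx := dense_orbit_basePoint.open_subset_closure_inter hopen (show x ∈ _ from rfl)
  refine closure_mono ?_ (image_closure_subset_closure_image hg.continuous (mem_image_of_mem g hx))
  rintro _ ⟨_, ⟨h, n, rfl⟩, rfl⟩
  refine ⟨_, mem_discretePiece.2 ⟨n, ?_, rfl⟩, (hg.apply_orbit n).symm⟩
  have h' : ((subshiftMap u)^[n] (basePoint u)).1 0 = x.1 0 := h
  rw [subshiftMap_iterate_apply_zero] at h'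
  exact h'

end IsPositionMap

end Position

/-! ### Overlaps -/

section Overlap

variable {A : Type*} [DecidableEq A] {P : Submodule ℝ (EuclideanSpace ℝ A)}
  (π : EuclideanSpace ℝ A →ₗ[ℝ] P) (u : ℕ → A)

/-- The points lying in two different pieces of the tile. -/
def pieceOverlap : Set P :=
  ⋃ a : A, ⋃ b : A, ⋃ _ : a ≠ b, tilePiece π u a ∩ tilePiece π u b

/-- The points that a translation by an element of `π(ℤ^A)` sends to two different pieces. -/
def singularSet : Set P := ⋃ z : A → ℤ, (fun p => p + intProj π z) ⁻¹' pieceOverlap π u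

/-- The points lying in two different translates of the tile by `π(Γ₀)`. -/
def translateOverlap : Set P :=
  ⋃ s : projGamma0 π, ⋃ t : projGamma0 π, ⋃ _ : s ≠ t,
    ((fun x => x + (s : P)) '' tile π u) ∩ ((fun x => x + (t : P)) '' tile π u)

variable {π u}

theorem eq_of_mem_tilePiece {a b : A} {p : P} (hp : p ∉ pieceOverlap π u)
    (ha : p ∈ tilePiece π u a) (hb : p ∈ tilePiece π u b) : a = b := by
  by_contra h
  exact hp (mem_iUnion.2 ⟨a, mem_iUnion.2 ⟨b, mem_iUnion.2 ⟨h, ha, hb⟩⟩⟩)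

theorem pieceOverlap_subset_singularSet : pieceOverlap π u ⊆ singularSet π u := by
  intro p hp
  refine mem_iUnion.2 ⟨0, ?_⟩
  simpa using hp

theorem add_intProj_mem_singularSet {p : P} {z : A → ℤ} :
    p + intProj π z ∈ singularSet π u ↔ p ∈ singularSet π u := by
  simp only [singularSet, mem_iUnion, mem_preimage, add_assoc, ← map_add]
  constructor
  · rintro ⟨w, hw⟩
    exact ⟨_, hw⟩
  · rintro ⟨w, hw⟩
    exact ⟨w - z, by rwa [add_sub_cancel]⟩

theorem add_mem_translateOverlap {p γ : P} (hγ : γ ∈ projGamma0 π)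
    (hp : p ∈ translateOverlap π u) : p + γ ∈ translateOverlap π u := by
  simp only [translateOverlap, mem_iUnion] at hp ⊢
  obtain ⟨s, t, hst, ⟨x, hx, hxp⟩, ⟨y, hy, hyp⟩⟩ := hp
  refine ⟨s + ⟨γ, hγ⟩, t + ⟨γ, hγ⟩, fun h => hst (add_right_cancel h), ⟨x, hx, ?_⟩, ⟨y, hy, ?_⟩⟩
  · simp [← hxp, add_assoc]
  · simp [← hyp, add_assoc]

/-- If p ≠ q had the same class, p would lie both in the tile and in its translate by p − q ∈ π(Γ₀).
-/
theorem eq_of_torusMk_eq {p q : P} (hp : p ∈ tile π u) (hq : q ∈ tile π u)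
    (h : torusMk π p = torusMk π q) (hpT : p ∉ translateOverlap π u) : p = q := by
  by_contra hne
  have hmem : p - q ∈ projGamma0 π := by rw [← torusMk_eq_zero, map_sub, h, sub_self]
  refine hpT ?_
  simp only [translateOverlap, mem_iUnion]
  refine ⟨0, ⟨p - q, hmem⟩, ?_, ⟨p, hp, by simp⟩, ⟨q, hq, by simp⟩⟩
  intro h0
  exact hne (sub_eq_zero.1 (congrArg Subtype.val h0).symm)

variable [Fintype A]

theorem isCompact_pieceOverlap (hbdd : Bornology.IsBounded (intProj π '' discreteLine u)) :
    IsCompact (pieceOverlap π u) :=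
  isCompact_iUnion fun a => isCompact_iUnion fun b => isCompact_iUnion fun _ =>
    (isCompact_tilePiece hbdd a).inter (isCompact_tilePiece hbdd b)

theorem volume_pieceOverlap
    (hdisj : ∀ a b : A, a ≠ b → volume (tilePiece π u a ∩ tilePiece π u b) = 0) :
    volume (pieceOverlap π u) = 0 := by
  simp only [pieceOverlap, measure_iUnion_null_iff]
  exact hdisj

theorem volume_singularSet
    (hdisj : ∀ a b : A, a ≠ b → volume (tilePiece π u a ∩ tilePiece π u b) = 0) :
    volume (singularSet π u) = 0 := by
  simp only [singularSet, measure_iUnion_null_iff]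
  intro z
  rw [measure_preimage_add_right]
  exact volume_pieceOverlap hdisj

theorem isSigmaCompact_singularSet (hbdd : Bornology.IsBounded (intProj π '' discreteLine u)) :
    IsSigmaCompact (singularSet π u) :=
  isSigmaCompact_iUnion _ fun z => ((Homeomorph.addRight (intProj π z)).isCompact_preimage.2
    (isCompact_pieceOverlap hbdd)).isSigmaCompact

theorem volume_translateOverlap
    (h : ∀ s ∈ projGamma0 π, ∀ t ∈ projGamma0 π, s ≠ t →
      volume (((fun x => x + s) '' tile π u) ∩ ((fun x => x + t) '' tile π u)) = 0) :
    volume (translateOverlap π u) = 0 := by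
  have : Countable (projGamma0 π) := countable_projGamma0.to_subtype
  simp only [translateOverlap, measure_iUnion_null_iff]
  exact fun s t hst => h s s.2 t t.2 fun h => hst (Subtype.ext h)

theorem isSigmaCompact_translateOverlap
    (hbdd : Bornology.IsBounded (intProj π '' discreteLine u)) :
    IsSigmaCompact (translateOverlap π u) := by
  have : Countable (projGamma0 π) := countable_projGamma0.to_subtype
  refine isSigmaCompact_iUnion _ fun s => isSigmaCompact_iUnion _ fun t =>
    IsCompact.isSigmaCompact (isCompact_iUnion fun _ => ?_)
  exact ((isCompact_tile hbdd).image (by fun_prop)).inter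
    ((isCompact_tile hbdd).image (by fun_prop))

end Overlap

/-! ### The domain exchange -/

section DomainExchange

variable {A : Type*} [Fintype A] [DecidableEq A] {P : Submodule ℝ (EuclideanSpace ℝ A)}
  {π : EuclideanSpace ℝ A →ₗ[ℝ] P} {u : ℕ → A}

theorem coe_domainExchange {x : tile π u} {a : A} (ha : (x : P) ∈ tilePiece π u a)
    (hx : (x : P) ∉ pieceOverlap π u) :
    (domainExchange π u x : P) = x + intProj π (basisVec a) := by
  have h : ∃! a : A, (x : P) ∈ tilePiece π u a :=
    ⟨a, ha, fun b hb => eq_of_mem_tilePiece hx hb ha⟩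
  rw [domainExchange, dif_pos h]
  simp only [eq_of_mem_tilePiece hx h.choose_spec.1 ha]

theorem domainExchange_of_mem {x : tile π u} (hx : (x : P) ∈ pieceOverlap π u) :
    domainExchange π u x = x := by
  have h : ¬ ∃! a : A, (x : P) ∈ tilePiece π u a := by
    rintro ⟨c, -, hc⟩
    simp only [pieceOverlap, mem_iUnion] at hx
    obtain ⟨a, b, hab, ha, hb⟩ := hx
    exact hab ((hc a ha).trans (hc b hb).symm)
  rw [domainExchange, dif_neg h]

theorem measurable_domainExchange (hbdd : Bornology.IsBounded (intProj π '' discreteLine u))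
    (hcover : ∀ p ∈ tile π u, ∃ a, p ∈ tilePiece π u a) :
    Measurable (domainExchange π u) := by
  have ho : MeasurableSet (pieceOverlap π u) := (isCompact_pieceOverlap hbdd).measurableSet
  have hval : Measurable (Subtype.val : tile π u → P) := measurable_subtype_coe
  intro s hs
  have hs' : MeasurableSet ((↑) '' s : Set P) :=
    (MeasurableEmbedding.subtype_coe (isCompact_tile hbdd).measurableSet).measurableSet_image.2 hs
  -- By convention the exchange is the identity on the overlap; elsewhere it is one translation on
  -- each of finitely many pieces.
  have : domainExchange π u ⁻¹' s = ((↑) ⁻¹' pieceOverlap π u ∩ s) ∪ ⋃ a : A,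
      (↑) ⁻¹' ((tilePiece π u a \ pieceOverlap π u) ∩
        (fun p => p + intProj π (basisVec a)) ⁻¹' ((↑) '' s)) := by
    ext x
    simp only [mem_preimage, mem_union, mem_inter_iff, mem_iUnion, mem_sdiff]
    by_cases hx : (x : P) ∈ pieceOverlap π u
    · simp [hx, domainExchange_of_mem hx]
    · simp only [hx, false_and, false_or, not_false_eq_true, and_true]
      obtain ⟨a, ha⟩ := hcover x x.2
      constructor
      · exact fun h => ⟨a, ha, _, h, coe_domainExchange ha hx⟩
      · rintro ⟨b, hb, y, hy, hyx⟩
        rw [← coe_domainExchange hb hx] at hyx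
        rwa [← Subtype.ext hyx]
  rw [this]
  refine ((hval ho).inter hs).union (MeasurableSet.iUnion fun a => hval ?_)
  exact ((isCompact_tilePiece hbdd a).measurableSet.diff ho).inter
    (measurable_add_const _ hs')

theorem tileMeasure_apply (hbdd : Bornology.IsBounded (intProj π '' discreteLine u))
    (s : Set (tile π u)) :
    tileMeasure π u s = (volume (tile π u))⁻¹ * volume ((↑) '' s : Set P) := by
  rw [tileMeasure, Measure.smul_apply, smul_eq_mul,
    (MeasurableEmbedding.subtype_coe (isCompact_tile hbdd).measurableSet).comap_apply]

theorem isProbabilityMeasure_tileMeasure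
    (hbdd : Bornology.IsBounded (intProj π '' discreteLine u)) (h0 : volume (tile π u) ≠ 0) :
    IsProbabilityMeasure (tileMeasure π u) :=
  ⟨by
    rw [tileMeasure_apply hbdd, image_univ, Subtype.range_coe]
    exact ENNReal.inv_mul_cancel h0 (isCompact_tile hbdd).measure_ne_top⟩

theorem tileMeasure_preimage_eq_zero (hbdd : Bornology.IsBounded (intProj π '' discreteLine u))
    {N : Set P} (hN : volume N = 0) : tileMeasure π u ((↑) ⁻¹' N) = 0 := by
  rw [tileMeasure_apply hbdd, measure_mono_null (image_preimage_subset _ _) hN, mul_zero]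

/-- Since the translated pieces cover the tile, a set s is covered, up to a null set, by translates
of the parts of E⁻¹(s) in the various pieces. Thus s has at most the measure of E⁻¹(s), and finite
total mass turns this into equality. -/
theorem measurePreserving_domainExchange
    (hbdd : Bornology.IsBounded (intProj π '' discreteLine u)) (h0 : volume (tile π u) ≠ 0)
    (hdisj : ∀ a b : A, a ≠ b → volume (tilePiece π u a ∩ tilePiece π u b) = 0)
    (hcover : ∀ p ∈ tile π u, ∃ a, p ∈ tilePiece π u a)
    (hcover' : ∀ p ∈ tile π u, ∃ a, ∃ q ∈ tilePiece π u a, p = q + intProj π (basisVec a)) :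
    MeasurePreserving (domainExchange π u) (tileMeasure π u) (tileMeasure π u) := by
  have := isProbabilityMeasure_tileMeasure hbdd h0
  have ho : MeasurableSet (pieceOverlap π u) := (isCompact_pieceOverlap hbdd).measurableSet
  have hE := measurable_domainExchange hbdd hcover
  refine measurePreserving_of_le_measure_preimage hE fun s hs => ?_
  rw [tileMeasure_apply hbdd, tileMeasure_apply hbdd]
  refine mul_le_mul' le_rfl ?_
  set s' : Set P := (↑) '' (domainExchange π u ⁻¹' s) with hs'
  have hs'm : MeasurableSet s' :=
    (MeasurableEmbedding.subtype_coe (isCompact_tile hbdd).measurableSet).measurableSet_image.2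
      (hE hs)
  have hsub : ((↑) '' s : Set P) ⊆
      (⋃ a : A, (fun p => p + -intProj π (basisVec a)) ⁻¹' pieceOverlap π u) ∪
      ⋃ a : A, (fun p => p + -intProj π (basisVec a)) ⁻¹'
        (s' ∩ (tilePiece π u a \ pieceOverlap π u)) := by
    rintro _ ⟨p, hp, rfl⟩
    obtain ⟨a, q, hq, hpq⟩ := hcover' p p.2
    by_cases hqo : q ∈ pieceOverlap π u
    · refine Or.inl (mem_iUnion.2 ⟨a, ?_⟩)
      simpa [hpq] using hqo
    · refine Or.inr (mem_iUnion.2 ⟨a, ?_⟩)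
      have hqt : q ∈ tile π u := tilePiece_subset_tile a hq
      have hEq : domainExchange π u ⟨q, hqt⟩ = p :=
        Subtype.ext ((coe_domainExchange (x := ⟨q, hqt⟩) hq hqo).trans hpq.symm)
      have hqs : q ∈ s' := ⟨⟨q, hqt⟩, by rwa [mem_preimage, hEq], rfl⟩
      rw [mem_preimage, hpq, add_neg_cancel_right]
      exact ⟨hqs, hq, hqo⟩
  refine (measure_mono hsub).trans ((measure_union_le _ _).trans ?_)
  have h1 : volume (⋃ a : A, (fun p => p + -intProj π (basisVec a)) ⁻¹' pieceOverlap π u) = 0 := by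
    simp only [measure_iUnion_null_iff]
    intro a
    rw [measure_preimage_add_right]
    exact volume_pieceOverlap hdisj
  rw [h1, zero_add]
  refine (measure_iUnion_le _).trans ?_
  simp_rw [measure_preimage_add_right]
  -- Without the overlap the pieces are disjoint, so the volumes add up to at most that of E⁻¹(s).
  rw [← measure_iUnion]
  · exact measure_mono (iUnion_subset fun a => inter_subset_left)
  · intro a b hab
    refine disjoint_left.2 fun p hpa hpb => hab ?_
    exact eq_of_mem_tilePiece hpa.2.2 hpa.2.1 hpb.2.1
  · exact fun a => hs'm.inter ((isCompact_tilePiece hbdd a).measurableSet.diff ho)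

end DomainExchange

/-! ### Properties of the position map -/

namespace IsPositionMap

section Topology

variable {A : Type*} [TopologicalSpace A] [DiscreteTopology A] [Fintype A] [DecidableEq A]
  {u : ℕ → A} {P : Submodule ℝ (EuclideanSpace ℝ A)} {π : EuclideanSpace ℝ A →ₗ[ℝ] P}
  {g : subshift u → P}

theorem exists_mem_tilePiece (hg : IsPositionMap π u g) :
    ∀ p ∈ tile π u, ∃ a, p ∈ tilePiece π u a := by
  rw [← hg.range_eq]
  rintro _ ⟨x, rfl⟩
  exact ⟨_, hg.mem_tilePiece x⟩

/-- Minimality makes the shift surjective, so every position is reached by a step from an earlier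
one. -/
theorem exists_mem_tilePiece_add (hg : IsPositionMap π u g)
    (hmin : IsMinimalSystem (subshiftMap u)) :
    ∀ p ∈ tile π u, ∃ a, ∃ q ∈ tilePiece π u a, p = q + intProj π (basisVec a) := by
  rw [← hg.range_eq]
  rintro _ ⟨x, rfl⟩
  obtain ⟨y, rfl⟩ := hmin.surjective continuous_subshiftMap x
  exact ⟨_, _, hg.mem_tilePiece y, hg.apply_shift y⟩

-- Off the singular set the position gives the first letter, hence the same step for both words;
-- invariance under π(ℤ^A) keeps the next position regular, so all letters agree by induction.
omit [Fintype A] in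
theorem injective_of_notMem_singularSet (hg : IsPositionMap π u g) {x y : subshift u}
    (hx : g x ∉ singularSet π u) (hxy : g x = g y) : x = y := by
  have key : ∀ n : ℕ, g ((subshiftMap u)^[n] x) ∉ singularSet π u ∧
      g ((subshiftMap u)^[n] x) = g ((subshiftMap u)^[n] y) := by
    intro n
    induction n with
    | zero => exact ⟨hx, hxy⟩
    | succ n ih =>
      obtain ⟨h1, h2⟩ := ih
      have h3 := eq_of_mem_tilePiece (fun h => h1 (pieceOverlap_subset_singularSet h))
        (hg.mem_tilePiece _) (h2 ▸ hg.mem_tilePiece ((subshiftMap u)^[n] y))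
      rw [Function.iterate_succ_apply', Function.iterate_succ_apply', hg.apply_shift,
        hg.apply_shift, ← h3, ← h2, add_intProj_mem_singularSet]
      exact ⟨h1, rfl⟩
  refine Subtype.ext (funext fun n => ?_)
  rw [← subshiftMap_iterate_apply_zero x, ← subshiftMap_iterate_apply_zero y]
  obtain ⟨h1, h2⟩ := key n
  exact eq_of_mem_tilePiece (fun h => h1 (pieceOverlap_subset_singularSet h))
    (hg.mem_tilePiece _) (h2 ▸ hg.mem_tilePiece ((subshiftMap u)^[n] y))

omit [DiscreteTopology A] [Fintype A] in
theorem torusMk_apply_shift (hg : IsPositionMap π u g) (a : A) (x : subshift u) :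
    torusMk π (g (subshiftMap u x)) = torusTranslation π a (torusMk π (g x)) := by
  rw [hg.apply_shift, map_add, torusMk_basisVec _ a, torusTranslation]

-- The image is compact and contains the forward orbit of 0 under the rotation. In a compact group,
-- density of the integer multiples implies density of the natural ones.
omit [DiscreteTopology A] in
theorem surjective_torusMk_comp (hg : IsPositionMap π u g) [T2Space (ProjTorus π)]
    [CompactSpace (ProjTorus π)] (hdense : DenseRange (intProj π)) :
    Function.Surjective fun x => torusMk π (g x) := by
  have hα := denseRange_zsmul_iff_nsmul.1 (denseRange_zsmul_torusMk hdense (u 0))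
  have hcont : Continuous fun x => torusMk π (g x) :=
    (continuous_torusMk π).comp hg.continuous
  rw [← range_eq_univ, ← (isCompact_range hcont).isClosed.closure_eq, ← dense_iff_closure_eq]
  refine hα.mono ?_
  rintro _ ⟨n, rfl⟩
  refine ⟨(subshiftMap u)^[n] (basePoint u), ?_⟩
  simp only
  rw [hg.apply_orbit, torusMk_intProj (u 0), sum_abelianVector_wordPrefix, natCast_zsmul]

omit [DiscreteTopology A] in
theorem isTopSemiconjugacy (hg : IsPositionMap π u g) [T2Space (ProjTorus π)]
    [CompactSpace (ProjTorus π)] (hdense : DenseRange (intProj π)) (a : A) :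
    IsTopSemiconjugacy (subshiftMap u) (torusTranslation π a) fun x => torusMk π (g x) :=
  ⟨(continuous_torusMk π).comp hg.continuous, hg.surjective_torusMk_comp hdense,
    hg.torusMk_apply_shift a⟩

-- Surjectivity onto the torus means that countably many translates of the tile cover the
-- hyperplane.
omit [DiscreteTopology A] in
theorem volume_tile_ne_zero (hg : IsPositionMap π u g) [T2Space (ProjTorus π)]
    [CompactSpace (ProjTorus π)] (hdense : DenseRange (intProj π)) :
    volume (tile π u) ≠ 0 := by
  intro h0
  have : Countable (projGamma0 π) := countable_projGamma0.to_subtype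
  have huniv : (univ : Set P) ⊆ ⋃ γ : projGamma0 π, (fun p => p + (γ : P)) ⁻¹' tile π u := by
    intro p _
    obtain ⟨x, hx⟩ := hg.surjective_torusMk_comp hdense (torusMk π p)
    have hmem : g x - p ∈ projGamma0 π := by
      rw [← torusMk_eq_zero, map_sub, sub_eq_zero]
      exact hx
    refine mem_iUnion.2 ⟨⟨g x - p, hmem⟩, ?_⟩
    simpa using hg.mem_tile x
  have h1 : volume (⋃ γ : projGamma0 π, (fun p => p + (γ : P)) ⁻¹' tile π u) = 0 := by
    simp only [measure_iUnion_null_iff, measure_preimage_add_right, h0, implies_true]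
  exact NeZero.ne (volume (univ : Set P)) (measure_mono_null huniv h1)

theorem encard_fiber (hg : IsPositionMap π u g) {y : ProjTorus π}
    (hy : y ∉ torusMk π '' singularSet π u) :
    ((fun x => torusMk π (g x)) ⁻¹' {y}).encard = (tile π u ∩ torusMk π ⁻¹' {y}).encard := by
  have himg : g '' ((fun x => torusMk π (g x)) ⁻¹' {y}) = tile π u ∩ torusMk π ⁻¹' {y} := by
    rw [← hg.range_eq, inter_comm, ← image_preimage_eq_inter_range]
    rfl
  rw [← himg, InjOn.encard_image]
  intro x hx x' _ hxx'
  exact hg.injective_of_notMem_singularSet (fun h => hy ⟨_, h, hx⟩) hxx'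

end Topology

end IsPositionMap

theorem finite_tile_inter_fiber {A : Type*} [DecidableEq A] [Fintype A]
    {P : Submodule ℝ (EuclideanSpace ℝ A)} {π : EuclideanSpace ℝ A →ₗ[ℝ] P} {u : ℕ → A}
    (hP : Module.finrank ℝ P + 1 = Fintype.card A) (hπ : ∀ x : P, π x = x)
    (hbdd : Bornology.IsBounded (intProj π '' discreteLine u)) (y : ProjTorus π) :
    (tile π u ∩ torusMk π ⁻¹' {y}).Finite := by
  obtain ⟨q, rfl⟩ := surjective_torusMk π y
  have hb : Bornology.IsBounded ((fun p => p - q) '' tile π u) :=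
    ((isCompact_tile hbdd).image (by fun_prop)).isBounded
  refine Finite.of_finite_image ((finite_inter_projGamma0 hP hπ hbdd hb).subset ?_)
    (sub_left_injective (b := q)).injOn
  rintro _ ⟨p, ⟨hp, hpq⟩, rfl⟩
  refine ⟨⟨p, hp, rfl⟩, ?_⟩
  rw [SetLike.mem_coe, ← torusMk_eq_zero, map_sub, sub_eq_zero]
  exact hpq

/-! ### Measures -/

section Measures

variable {A : Type*} [TopologicalSpace A] [DiscreteTopology A] [Fintype A] [DecidableEq A]
  [MeasurableSpace A] [BorelSpace A]
  {u : ℕ → A} {P : Submodule ℝ (EuclideanSpace ℝ A)} {π : EuclideanSpace ℝ A →ₗ[ℝ] P}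
  {g : subshift u → P}

omit [TopologicalSpace A] [DiscreteTopology A] [MeasurableSpace A] [BorelSpace A] in
theorem ergodic_torusTranslation [T2Space (ProjTorus π)] [CompactSpace (ProjTorus π)]
    (hdense : DenseRange (intProj π)) (a : A) :
    Ergodic (torusTranslation π a) (torusMeasure π) := by
  have := isProbabilityMeasure_torusMeasure (π := π)
  have := isAddHaarMeasure_torusMeasure (π := π)
  have h := ergodic_add_left_of_denseRange_zsmul (denseRange_zsmul_torusMk hdense a)
    (torusMeasure π)
  simp_rw [add_comm] at h
  exact h

namespace IsPositionMap

/-- An invariant probability measure on the subshift projects to the Haar measure of the torus. -/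
theorem measurePreserving_torusMk (hg : IsPositionMap π u g) [T2Space (ProjTorus π)]
    [CompactSpace (ProjTorus π)] (hdense : DenseRange (intProj π))
    (ν : Measure (subshift u)) [IsProbabilityMeasure ν]
    (hν : MeasurePreserving (subshiftMap u) ν ν) :
    MeasurePreserving (fun x => torusMk π (g x)) ν (torusMeasure π) := by
  have := isProbabilityMeasure_torusMeasure (π := π)
  have := isAddHaarMeasure_torusMeasure (π := π)
  have hφ : Measurable fun x => torusMk π (g x) :=
    ((continuous_torusMk π).comp hg.continuous).measurable
  have hT := (ergodic_torusTranslation hdense (u 0)).measurable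
  have : IsProbabilityMeasure (ν.map fun x => torusMk π (g x)) :=
    Measure.isProbabilityMeasure_map hφ.aemeasurable
  -- The image measure is invariant under the rotation, and Haar measure is the only such
  -- probability.
  refine ⟨hφ, eq_addHaar_of_measurePreserving_add (denseRange_zsmul_torusMk hdense (u 0)) _ _
    ⟨hT, ?_⟩⟩
  change Measure.map (torusTranslation π (u 0)) _ = _
  rw [Measure.map_map hT hφ]
  conv_rhs => rw [← hν.map_eq]
  rw [Measure.map_map hφ hν.measurable]
  congr 1
  funext x
  exact (hg.torusMk_apply_shift (u 0) x).symm

/-- The measurable section of the position map. -/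
theorem exists_section (hg : IsPositionMap π u g)
    (hbdd : Bornology.IsBounded (intProj π '' discreteLine u)) :
    ∃ ψ : tile π u → subshift u, Measurable ψ ∧
      (∀ p : tile π u, (p : P) ∉ singularSet π u → g (ψ p) = p) ∧
      ∀ x, g x ∉ singularSet π u → ψ ⟨g x, hg.mem_tile x⟩ = x := by
  have hN : MeasurableSet ((↑) ⁻¹' singularSet π u : Set (tile π u)) :=
    measurable_subtype_coe (isSigmaCompact_singularSet hbdd).measurableSet
  have hcont : Continuous fun x => (⟨g x, hg.mem_tile x⟩ : tile π u) :=
    hg.continuous.subtype_mk _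
  obtain ⟨ψ, hψ, h1, h2⟩ := exists_measurable_section hcont hN
    (fun p _ => by
      obtain ⟨x, hx⟩ : (p : P) ∈ range g := hg.range_eq.symm ▸ p.2
      exact ⟨x, Subtype.ext hx⟩)
    (fun x x' hx hxx' => hg.injective_of_notMem_singularSet hx (congrArg Subtype.val hxx'))
  exact ⟨ψ, hψ, fun p hp => congrArg Subtype.val (h1 p hp), h2⟩

/-- There is an invariant measure for which the position map is an isomorphism to the domain
exchange. -/
theorem exists_invariant_measure (hg : IsPositionMap π u g)
    (hbdd : Bornology.IsBounded (intProj π '' discreteLine u))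
    (hmin : IsMinimalSystem (subshiftMap u)) (h0 : volume (tile π u) ≠ 0)
    (hdisj : ∀ a b : A, a ≠ b → volume (tilePiece π u a ∩ tilePiece π u b) = 0) :
    ∃ μ : Measure (subshift u), IsProbabilityMeasure μ ∧
      MeasurePreserving (fun x => (⟨g x, hg.mem_tile x⟩ : tile π u)) μ (tileMeasure π u) ∧
      MeasurablyIsomorphic (subshiftMap u) μ (domainExchange π u) (tileMeasure π u) := by
  have := isProbabilityMeasure_tileMeasure hbdd h0
  obtain ⟨ψ, hψ, hgψ, hψg⟩ := hg.exists_section hbdd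
  have hcont : Continuous fun x => (⟨g x, hg.mem_tile x⟩ : tile π u) :=
    hg.continuous.subtype_mk _
  have hN : tileMeasure π u ((↑) ⁻¹' singularSet π u) = 0 :=
    tileMeasure_preimage_eq_zero hbdd (volume_singularSet hdisj)
  have hNae := measure_eq_zero_iff_ae_notMem.1 hN
  have hE := measurePreserving_domainExchange hbdd h0 hdisj hg.exists_mem_tilePiece
    (hg.exists_mem_tilePiece_add hmin)
  have hST : ∀ x, g x ∉ singularSet π u → (⟨g (subshiftMap u x), hg.mem_tile _⟩ : tile π u)
      = domainExchange π u ⟨g x, hg.mem_tile x⟩ := by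
    intro x hx
    refine Subtype.ext ?_
    rw [coe_domainExchange (hg.mem_tilePiece x) fun h => hx (pieceOverlap_subset_singularSet h)]
    exact hg.apply_shift x
  have hgψae : ∀ᵐ p ∂tileMeasure π u, (⟨g (ψ p), hg.mem_tile _⟩ : tile π u) = p := by
    filter_upwards [hNae] with p hp
    exact Subtype.ext (hgψ p hp)
  have hmp := measurePreserving_of_section hcont.measurable hψ hgψae
  -- The invariant measure is the normalised Lebesgue measure of the tile, carried to the subshift
  -- by the section of g.
  refine ⟨(tileMeasure π u).map ψ, Measure.isProbabilityMeasure_map hψ.aemeasurable, hmp, ?_, hE,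
    _, ψ, hmp, ⟨hψ, rfl⟩, ?_, hgψae, ?_⟩
  · exact MeasurePreserving.of_section hN continuous_subshiftMap.measurable hψ
      (fun p hp => Subtype.ext (hgψ p hp)) (fun x hx => hψg x hx) hE hST
  · filter_upwards [hmp.quasiMeasurePreserving.ae hNae] with x hx
    exact hψg x hx
  · filter_upwards [hmp.quasiMeasurePreserving.ae hNae] with x hx
    exact hST x hx

omit [DiscreteTopology A] [BorelSpace A] in
/-- A null set saturated modulo `π(Γ₀)` projects to a null set of the torus. -/
theorem torusMeasure_image_eq_zero (hg : IsPositionMap π u g) [T2Space (ProjTorus π)]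
    (hbdd : Bornology.IsBounded (intProj π '' discreteLine u)) {μ : Measure (subshift u)}
    (hφ : MeasurePreserving (fun x => torusMk π (g x)) μ (torusMeasure π))
    (hgμ : MeasurePreserving (fun x => (⟨g x, hg.mem_tile x⟩ : tile π u)) μ (tileMeasure π u))
    {N : Set P} (hN : IsSigmaCompact N) (hsat : ∀ p ∈ N, ∀ γ ∈ projGamma0 π, p + γ ∈ N)
    (h0 : volume N = 0) : torusMeasure π (torusMk π '' N) = 0 := by
  have hmeas : MeasurableSet (torusMk π '' N) :=
    (hN.image (continuous_torusMk π)).measurableSet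
  rw [← hφ.measure_preimage hmeas.nullMeasurableSet]
  -- Saturation says that g(x) lies in N as soon as its class does. Both measures are images of μ,
  -- so nullity passes from the tile to the torus through the subshift.
  have hpre : (fun x => torusMk π (g x)) ⁻¹' (torusMk π '' N) =
      (fun x => (⟨g x, hg.mem_tile x⟩ : tile π u)) ⁻¹' ((↑) ⁻¹' N) := by
    ext x
    constructor
    · rintro ⟨p, hp, hpx⟩
      have hmem : g x - p ∈ projGamma0 π := by
        rw [← torusMk_eq_zero, map_sub, sub_eq_zero]
        exact hpx.symm
      have := hsat p hp _ hmem
      rwa [add_sub_cancel] at this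
    · exact fun h => ⟨g x, h, rfl⟩
  have hNm : MeasurableSet ((↑) ⁻¹' N : Set (tile π u)) :=
    measurable_subtype_coe hN.measurableSet
  rw [hpre, hgμ.measure_preimage hNm.nullMeasurableSet]
  exact tileMeasure_preimage_eq_zero hbdd h0

omit [BorelSpace A] in
theorem isFiniteExtension (hg : IsPositionMap π u g) [T2Space (ProjTorus π)]
    [CompactSpace (ProjTorus π)] (hP : Module.finrank ℝ P + 1 = Fintype.card A)
    (hπ : ∀ x : P, π x = x) (hdense : DenseRange (intProj π))
    (hbdd : Bornology.IsBounded (intProj π '' discreteLine u))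
    (hmin : IsMinimalSystem (subshiftMap u)) {μ : Measure (subshift u)}
    (hμ : MeasurePreserving (subshiftMap u) μ μ)
    (hφ : MeasurePreserving (fun x => torusMk π (g x)) μ (torusMeasure π))
    (hsing : torusMeasure π (torusMk π '' singularSet π u) = 0) (a : A) :
    IsFiniteExtension (subshiftMap u) μ (torusTranslation π a) (torusMeasure π)
      fun x => torusMk π (g x) := by
  have := isProbabilityMeasure_torusMeasure (π := π)
  have hT := ergodic_torusTranslation hdense a
  have hae : ∀ᵐ y ∂torusMeasure π, ((fun x => torusMk π (g x)) ⁻¹' {y}).encard =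
      (tile π u ∩ torusMk π ⁻¹' {y}).encard := by
    filter_upwards [measure_eq_zero_iff_ae_notMem.1 hsing] with y hy
    exact hg.encard_fiber hy
  refine ⟨hμ, hT.toMeasurePreserving, hφ, .of_forall (hg.torusMk_apply_shift a), ?_⟩
  refine hT.exists_ae_eq_natCast (fun k => ?_) (fun y => ?_) (fun y => ?_) ?_
  · have hker : ((torusMk π).ker : Set P).Countable := by
      rw [ker_torusMk]
      exact countable_projGamma0
    have hm := measurableSet_le_encard_inter_fiber (continuous_torusMk π) hker
      (isCompact_tile hbdd) k
    refine hm.nullMeasurableSet.congr (Filter.eventuallyEq_set.2 ?_)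
    filter_upwards [hae] with y hy
    rw [hy]
  -- The shift is onto and translation on the torus is injective, so the fibre above T y is
  -- contained in the shifted fibre above y.
  · refine le_trans (encard_le_encard ?_) (encard_image_le (subshiftMap u) _)
    intro x hx
    obtain ⟨x', rfl⟩ := hmin.surjective continuous_subshiftMap x
    refine ⟨x', ?_, rfl⟩
    have hx' : torusMk π (g (subshiftMap u x')) = torusTranslation π a y := hx
    rw [hg.torusMk_apply_shift a] at hx'
    exact add_right_cancel hx'
  · rw [one_le_encard_iff_nonempty]
    exact hg.surjective_torusMk_comp hdense y
  · filter_upwards [hae] with y hy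
    rw [hy]
    exact (finite_tile_inter_fiber hP hπ hbdd y).encard_lt_top.ne

/-- When the translates of the tile do not overlap, the projection to the torus is an isomorphism
and the subshift is uniquely ergodic. -/
theorem isUniquelyErgodic_and_isomorphic (hg : IsPositionMap π u g) [T2Space (ProjTorus π)]
    [CompactSpace (ProjTorus π)] (hdense : DenseRange (intProj π))
    (hbdd : Bornology.IsBounded (intProj π '' discreteLine u))
    {μ : Measure (subshift u)} [IsProbabilityMeasure μ]
    (hμ : MeasurePreserving (subshiftMap u) μ μ)
    (hsing : torusMeasure π (torusMk π '' singularSet π u) = 0)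
    (htrans : torusMeasure π (torusMk π '' translateOverlap π u) = 0) :
    IsUniquelyErgodic (subshiftMap u) ∧ ∀ a : A,
      MeasurablyIsomorphic (subshiftMap u) μ (torusTranslation π a) (torusMeasure π) := by
  have hcont : Continuous fun x => torusMk π (g x) :=
    (continuous_torusMk π).comp hg.continuous
  have hNm : MeasurableSet (torusMk π '' singularSet π u ∪ torusMk π '' translateOverlap π u) :=
    ((isSigmaCompact_singularSet hbdd).image (continuous_torusMk π)).measurableSet.union
      ((isSigmaCompact_translateOverlap hbdd).image (continuous_torusMk π)).measurableSet
  have hNae := measure_eq_zero_iff_ae_notMem.1 (measure_union_null hsing htrans)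
  obtain ⟨ψ, hψ, h1, h2⟩ := exists_measurable_section hcont hNm
    (fun y _ => hg.surjective_torusMk_comp hdense y)
    (fun x x' hx hxx' => by
      refine hg.injective_of_notMem_singularSet (fun h => hx (Or.inl ⟨_, h, rfl⟩)) ?_
      exact eq_of_torusMk_eq (hg.mem_tile x) (hg.mem_tile x') hxx'
        fun h => hx (Or.inr ⟨_, h, rfl⟩))
  -- Every invariant probability projects to Haar measure, so the same null set is negligible for
  -- all of them and each is the image of Haar measure under the same ψ.
  have hinv : ∀ ν : Measure (subshift u), IsProbabilityMeasure ν →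
      MeasurePreserving (subshiftMap u) ν ν →
      (∀ᵐ x ∂ν, ψ (torusMk π (g x)) = x) ∧ MeasurePreserving ψ (torusMeasure π) ν := by
    intro ν _ hν
    have hφ := hg.measurePreserving_torusMk hdense ν hν
    have hae : ∀ᵐ x ∂ν, ψ (torusMk π (g x)) = x := by
      filter_upwards [hφ.quasiMeasurePreserving.ae hNae] with x hx
      exact h2 x hx
    have := measurePreserving_of_section hψ hφ.measurable hae
    rw [hφ.map_eq] at this
    exact ⟨hae, this⟩
  refine ⟨⟨μ, ⟨inferInstance, hμ⟩, fun ν hν => ?_⟩, fun a => ?_⟩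
  · rw [← (hinv ν hν.1 hν.2).2.map_eq, ← (hinv μ inferInstance hμ).2.map_eq]
  · obtain ⟨hae, hψμ⟩ := hinv μ inferInstance hμ
    refine ⟨hμ, (ergodic_torusTranslation hdense a).toMeasurePreserving, _, ψ,
      hg.measurePreserving_torusMk hdense μ hμ, hψμ, hae, ?_,
      .of_forall (hg.torusMk_apply_shift a)⟩
    filter_upwards [hNae] with y hy
    exact h1 y hy

end IsPositionMap

end Measures

end

theorem mainTheorem2 {A : Type*} [Fintype A] [DecidableEq A]
    [TopologicalSpace A] [DiscreteTopology A] [MeasurableSpace A] [BorelSpace A]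
    (u : ℕ → A)
    (P : Submodule ℝ (EuclideanSpace ℝ A)) (hP : Module.finrank ℝ P + 1 = Fintype.card A)
    (π : EuclideanSpace ℝ A →ₗ[ℝ] P) (hπ : ∀ x : P, π x = x)
    (hdense : DenseRange (intProj π))
    (hbdd : Bornology.IsBounded (intProj π '' discreteLine u))
    (hmin : IsMinimalSystem (subshiftMap u))
    (hfrontier : ∀ a : A, volume (frontier (tilePiece π u a)) = 0)
    (hdisj : ∀ a b : A, a ≠ b → volume (tilePiece π u a ∩ tilePiece π u b) = 0) :
    ∃ μ : Measure (subshift u), IsProbabilityMeasure μ ∧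
      MeasurePreserving (subshiftMap u) μ μ ∧
      IsProbabilityMeasure (torusMeasure π) ∧
      (∃ φ : subshift u → ProjTorus π, ∀ a : A,
        IsFiniteExtension (subshiftMap u) μ (torusTranslation π a) (torusMeasure π) φ ∧
        IsTopSemiconjugacy (subshiftMap u) (torusTranslation π a) φ) ∧
      ((∀ s ∈ projGamma0 π, ∀ t ∈ projGamma0 π, s ≠ t →
          volume (((fun x => x + s) '' tile π u) ∩ ((fun x => x + t) '' tile π u)) = 0) →
        IsUniquelyErgodic (subshiftMap u) ∧
        (∀ a : A, MeasurablyIsomorphic (subshiftMap u) μ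
          (torusTranslation π a) (torusMeasure π)) ∧
        MeasurablyIsomorphic (subshiftMap u) μ (domainExchange π u) (tileMeasure π u)) := by
  have := t2Space_projTorus hP hπ hbdd
  have := compactSpace_projTorus hP hπ hbdd
  obtain ⟨g, hg⟩ := exists_isPositionMap hbdd hmin
  obtain ⟨μ, hμp, hgμ, hiso⟩ := hg.exists_invariant_measure hbdd hmin
    (hg.volume_tile_ne_zero hdense) hdisj
  have hμ := hiso.1
  have hφ := hg.measurePreserving_torusMk hdense μ hμ
  -- The singular set is invariant under all of π(ℤ^A), in particular under π(Γ₀).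
  have hsing := hg.torusMeasure_image_eq_zero hbdd hφ hgμ (isSigmaCompact_singularSet hbdd)
    (by
      rintro p hp _ ⟨z, -, rfl⟩
      exact add_intProj_mem_singularSet.2 hp) (volume_singularSet hdisj)
  refine ⟨μ, hμp, hμ, isProbabilityMeasure_torusMeasure, ⟨fun x => torusMk π (g x), fun a =>
    ⟨hg.isFiniteExtension hP hπ hdense hbdd hmin hμ hφ hsing a,
      hg.isTopSemiconjugacy hdense a⟩⟩, fun htrans => ?_⟩
  have hover := hg.torusMeasure_image_eq_zero hbdd hφ hgμ (isSigmaCompact_translateOverlap hbdd)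
    (fun p hp γ hγ => add_mem_translateOverlap hγ hp) (volume_translateOverlap htrans)
  obtain ⟨hue, hti⟩ := hg.isUniquelyErgodic_and_isomorphic hdense hbdd hμ hsing hover
  exact ⟨hue, hti, hiso⟩
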